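/- Let $C,G\in\mathbb R^{N\times N}$, where $C$ is symmetric positive semidefinite and $G$ is positive definite but not necessarily symmetric ($v^\top Gv>0$ for all real $v\ne0$). Write $C=V_CC_1V_C^\top$, where $V_C\in\mathbb R^{N\times n}$ has orthonormal columns and $C_1$ is diagonal with positive diagonal entries, and put $P_C=V_CV_C^\top$, $\|v\|_C=\sqrt{v^\top Cv}$. For a matrix $A\in\mathbb R^{N\times N}$ let $\mathcal F_C(A)=\{x^*CAx: x\in\mathbb C^N,\ x^*Cx=1\}$, and let $\mathcal D(c,\rho)$ be the closed disk with centre $c$ and radius $\rho$. Put $B=G^{-1}C$, $B_{1,1}=V_C^\top BV_C$ and, for $\gamma>0$, $S=S_\gamma=P_C(C+\gamma G)^{-1}C$ and $g(\mu)=(1+\gamma\mu^{-1})^{-1}$. Let $\varphi_k(z)=\sum_{j\ge0}z^j/(j+k)!$, so that $\varphi_0=\exp$ and $\varphi_{k+1}(z)=(\varphi_k(z)-1/k!)/z$. For $t\ge 0$ put, with $\sigma(\lambda)=(\lambda^{-1}-1)/\gamma$, $$f(\lambda)=\varphi_0(-t\sigma(\lambda)),\qquad f_k(\lambda)=\sigma(\lambda)\,\varphi_k(-t\sigma(\lambda))\quad(k=1,2),$$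 for nonzero complex $\lambda$ and, in the same way, for invertible square matrices. For $x(0),u(0),u'(0)\in\mathbb R^N$ let $$x_{\mathcal R}(t)=V_C\varphi_0(-tB_{1,1}^{-1})V_C^\top x(0)+tV_CB_{1,1}^{-1}\varphi_1(-tB_{1,1}^{-1})V_C^\top G^{-1}u(0)+t^2V_CB_{1,1}^{-1}\varphi_2(-tB_{1,1}^{-1})V_C^\top G^{-1}u'(0).$$ Given $v\in\mathbb R^N$ and $m\ge1$, at most $m$ steps of the $C$-orthogonal Arnoldi iteration for $S$ with starting vector $P_Cv$ produce a pair $(W,H)$, $W=[w_1,\dots,w_k]\in\mathbb R^{N\times k}$, $k\le m$, with $W^\top CW=I$, $\|v\|_C\,w_1=P_Cv$ (and $k=0$ only if $P_Cv=0$), $H$ upper Hessenberg with positive subdiagonal, and $SW=WH+h_{k+1,k}w_{k+1}e_k^\top$ where $W^\top C(h_{k+1,k}w_{k+1})=0$, and $h_{k+1,k}w_{k+1}=0$ if $k<m$ (early breakdown). Let $(W^{(0)},H^{(0)})$, $(W^{(1)},H^{(1)})$, $(W^{(2)},H^{(2)})$ be such pairs for $v=x(0)$, $v=G^{-1}u(0)$,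 $v=G^{-1}u'(0)$ respectively, with the same $m$, and let $$x_a(t)=W^{(0)}f(H^{(0)})W^{(0)\top}Cx(0)+t\,W^{(1)}f_1(H^{(1)})W^{(1)\top}CG^{-1}u(0)+t^2\,W^{(2)}f_2(H^{(2)})W^{(2)\top}CG^{-1}u'(0).$$ **Theorem.** 1. There are real numbers $c_1>\rho_1>0$ with $\mathcal F_C(B)\subset\mathcal D(c_1,\rho_1)$ such that, for every $\gamma>0$, one has $\mathcal F_C(S)\subset\mathcal D(c_0,\rho_0)$ with $c_0=\tfrac12\big(g(c_1-\rho_1)+g(c_1+\rho_1)\big)$, $\rho_0=\tfrac12\big(g(c_1+\rho_1)-g(c_1-\rho_1)\big)$, and $0<\rho_0<c_0<1$. 2. If $x$ is differentiable on $[0,\infty)$ and satisfies $Cx'(s)+Gx(s)=u(0)+s\,u'(0)$ for all $s\ge0$, then $P_Cx(t)=x_{\mathcal R}(t)$ for all $t\ge0$. 3. Let $\gamma>0$, let $0<\rho_0<c_0\le1$ be any numbers with $\mathcal F_C(S)\subset\mathcal D(c_0,\rho_0)$, let $r\in(\rho_0,c_0)$, and let $\Gamma$ be the circle with centre $c_0$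 and radius $r$. Then for all $t\ge0$, all $m\ge1$, and all $x(0),u(0),u'(0)$, $$\|x_{\mathcal R}(t)-x_a(t)\|_C\le\max_{\lambda\in\Gamma}\Big(|f(\lambda)|\,\|x(0)\|_C+t\,|f_1(\lambda)|\,\|G^{-1}u(0)\|_C+t^2\,|f_2(\lambda)|\,\|G^{-1}u'(0)\|_C\Big)\cdot\frac{4}{r-\rho_0}\Big(\frac{\rho_0}{r}\Big)^m ,$$ where the maximum is attained. Since $\rho_0/r<1$, the bound decays geometrically in $m$. -/

import Mathlib

open Matrix

noncomputable section

namespace CArnoldi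

/-- Positive definiteness of a real square matrix that need not be symmetric. -/
def PosDefNonsymm {N : ℕ} (G : Matrix (Fin N) (Fin N) ℝ) : Prop :=
  ∀ v : Fin N → ℝ, v ≠ 0 → 0 < v ⬝ᵥ (G *ᵥ v)

/-- The `C`-seminorm of a real vector. -/
def cNorm {N : ℕ} (C : Matrix (Fin N) (Fin N) ℝ) (v : Fin N → ℝ) : ℝ :=
  Real.sqrt (v ⬝ᵥ (C *ᵥ v))

/-- The `C`-numerical range: the values `x^* C A x` over complex vectors with `x^* C x = 1`. -/
def cNumericalRange {N : ℕ} (C A : Matrix (Fin N) (Fin N) ℝ) : Set ℂ :=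
  {z | ∃ x : Fin N → ℂ, star x ⬝ᵥ ((C.map Complex.ofReal) *ᵥ x) = 1 ∧
    z = star x ⬝ᵥ (((C * A).map Complex.ofReal) *ᵥ x)}

/-- The eigenvector decomposition of `C` restricted to its nonzero eigenvalues: `VC` has
orthonormal columns and `C = VC * C₁ * VCᵀ` with `C₁` diagonal and positive. -/
structure IsEigenDecomposition {N n : ℕ} (C : Matrix (Fin N) (Fin N) ℝ)
    (VC : Matrix (Fin N) (Fin n) ℝ) (d : Fin n → ℝ) : Prop where
  pos : ∀ i, 0 < d i
  orthonormal : VCᵀ * VC = 1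
  eq : C = VC * Matrix.diagonal d * VCᵀ

/-- The orthogonal projection on the range of `C`. -/
def rangeProj {N n : ℕ} (VC : Matrix (Fin N) (Fin n) ℝ) : Matrix (Fin N) (Fin N) ℝ :=
  VC * VCᵀ

/-- The operator `B = G⁻¹ C`. -/
def opB {N : ℕ} (C G : Matrix (Fin N) (Fin N) ℝ) : Matrix (Fin N) (Fin N) ℝ :=
  G⁻¹ * C

/-- The compression `B₁₁ = VCᵀ B VC`. -/
def opB11 {N n : ℕ} (C G : Matrix (Fin N) (Fin N) ℝ) (VC : Matrix (Fin N) (Fin n) ℝ) :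
    Matrix (Fin n) (Fin n) ℝ :=
  VCᵀ * opB C G * VC

/-- The shift-and-invert operator `S = P_C (C + γ G)⁻¹ C`. -/
def opS {N n : ℕ} (C G : Matrix (Fin N) (Fin N) ℝ) (VC : Matrix (Fin N) (Fin n) ℝ) (γ : ℝ) :
    Matrix (Fin N) (Fin N) ℝ :=
  rangeProj VC * (C + γ • G)⁻¹ * C

/-- The entire function `φ_k(a) = ∑_j a^j / (j + k)!`, for scalars and for square matrices.
It satisfies `φ_0 = exp` and `z φ_{k+1}(z) = φ_k(z) - 1/k!`. -/
def phi {A : Type*} [Ring A] [Algebra ℝ A] [TopologicalSpace A] (k : ℕ) (a : A) : A :=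
  ∑' j : ℕ, ((j + k).factorial : ℝ)⁻¹ • a ^ j

/-- `g₁(a)⁻¹ = (a⁻¹ - 1) / γ`, for scalars and for square matrices. -/
def gInv {A : Type*} [Ring A] [Algebra ℝ A] [Inv A] (γ : ℝ) (a : A) : A :=
  γ⁻¹ • (a⁻¹ - 1)

/-- `f(a) = φ_0(-t g₁(a)⁻¹)`, for scalars and for square matrices. -/
def f0 {A : Type*} [Ring A] [Algebra ℝ A] [TopologicalSpace A] [Inv A] (γ t : ℝ) (a : A) : A :=
  phi 0 (-(t • gInv γ a))

/-- `f_k(a) = g₁(a)⁻¹ φ_k(-t g₁(a)⁻¹)`, for scalars and for square matrices. -/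
def fk {A : Type*} [Ring A] [Algebra ℝ A] [TopologicalSpace A] [Inv A] (k : ℕ) (γ t : ℝ)
    (a : A) : A :=
  gInv γ a * phi k (-(t • gInv γ a))

/-- The Möbius function `g(μ) = (1 + γ μ⁻¹)⁻¹` at a real argument. -/
def gMob (γ μ : ℝ) : ℝ := (1 + γ * μ⁻¹)⁻¹

/-- Centre of the disk with diameter `[g(c₁ - ρ₁), g(c₁ + ρ₁)]`. -/
def diskCentre (γ c₁ ρ₁ : ℝ) : ℝ := (gMob γ (c₁ - ρ₁) + gMob γ (c₁ + ρ₁)) / 2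

/-- Radius of the disk with diameter `[g(c₁ - ρ₁), g(c₁ + ρ₁)]`. -/
def diskRadius (γ c₁ ρ₁ : ℝ) : ℝ := (gMob γ (c₁ + ρ₁) - gMob γ (c₁ - ρ₁)) / 2

/-- The range component `x_R(t)` of the solution of `C x' + G x = u₀ + t u₁`, `x(0) = x₀`. -/
def xR {N n : ℕ} (C G : Matrix (Fin N) (Fin N) ℝ) (VC : Matrix (Fin N) (Fin n) ℝ) (t : ℝ)
    (x₀ u₀ u₁ : Fin N → ℝ) : Fin N → ℝ :=
  (VC * phi 0 (-(t • (opB11 C G VC)⁻¹)) * VCᵀ) *ᵥ x₀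
    + t • ((VC * (opB11 C G VC)⁻¹ * phi 1 (-(t • (opB11 C G VC)⁻¹)) * VCᵀ * G⁻¹) *ᵥ u₀)
    + t ^ 2 • ((VC * (opB11 C G VC)⁻¹ * phi 2 (-(t • (opB11 C G VC)⁻¹)) * VCᵀ * G⁻¹) *ᵥ u₁)

/-- `(W, H)` is produced by at most `m` steps of the `C`-orthogonal Arnoldi iteration for `S`
started from `P v`; `k` is the dimension reached, with `k < m` only after a breakdown.
The vector `q` stands for `h_{k+1,k} w_{k+1}`, so that `S W = W H + h_{k+1,k} w_{k+1} e_kᵀ`. -/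
structure IsArnoldi {N : ℕ} (C S P : Matrix (Fin N) (Fin N) ℝ) (v : Fin N → ℝ) (m k : ℕ)
    (W : Matrix (Fin N) (Fin k) ℝ) (H : Matrix (Fin k) (Fin k) ℝ) : Prop where
  dim_le : k ≤ m
  orthonormal : Wᵀ * C * W = 1
  start : ∀ j : Fin k, (j : ℕ) = 0 → P *ᵥ v = cNorm C v • W.col j
  start_zero : k = 0 → P *ᵥ v = 0
  hessenberg : ∀ i j : Fin k, (j : ℕ) + 1 < i → H i j = 0
  subdiag_pos : ∀ i j : Fin k, (i : ℕ) = j + 1 → 0 < H i j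
  recurrence : ∃ q : Fin N → ℝ, Wᵀ *ᵥ (C *ᵥ q) = 0 ∧ (k < m → q = 0) ∧
    S * W = W * H + Matrix.of (fun a (j : Fin k) => if (j : ℕ) + 1 = k then q a else 0)

/-- The Arnoldi approximation `x_a(t)`: each of the data `x₀`, `G⁻¹ u₀`, `G⁻¹ u₁` is treated
with its own Arnoldi pair. -/
def xa {N k₀ k₁ k₂ : ℕ} (C G : Matrix (Fin N) (Fin N) ℝ) (γ t : ℝ) (x₀ u₀ u₁ : Fin N → ℝ)
    (W₀ : Matrix (Fin N) (Fin k₀) ℝ) (H₀ : Matrix (Fin k₀) (Fin k₀) ℝ)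
    (W₁ : Matrix (Fin N) (Fin k₁) ℝ) (H₁ : Matrix (Fin k₁) (Fin k₁) ℝ)
    (W₂ : Matrix (Fin N) (Fin k₂) ℝ) (H₂ : Matrix (Fin k₂) (Fin k₂) ℝ) : Fin N → ℝ :=
  (W₀ * f0 γ t H₀ * W₀ᵀ * C) *ᵥ x₀
    + t • ((W₁ * fk 1 γ t H₁ * W₁ᵀ * C) *ᵥ (G⁻¹ *ᵥ u₀))
    + t ^ 2 • ((W₂ * fk 2 γ t H₂ * W₂ᵀ * C) *ᵥ (G⁻¹ *ᵥ u₁))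

end CArnoldi

end

/-! Write `C = Eᵀ E` with `E` (`factorE`) having a right inverse. Then `E` turns the `C`-seminorm
into the Euclidean norm on `ℝⁿ`, intertwines `B` with `M = E G⁻¹ Eᵀ` and `S` with `T = (M + γ)⁻¹ M`,
and sends the Arnoldi basis `W` to a matrix `Q = E W` with orthonormal columns. So everything
happens in `ℝⁿ`, where `M` is positive definite.

Disks: a coercive `M` satisfies `‖M x - c x‖ ≤ ρ ‖x‖` for some `0 < ρ < c`. Operator norm disks,
unlike general numerical range disks, are carried by the Möbius map `g` to operator norm disks, so
`T` inherits one for every `γ` (`norm_sub_diskCentre_smul_le`). Cauchy–Schwarz returns to numerical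
ranges.

Solution: applying `E G⁻¹` to the system gives `M y' + y = b₀ + s b₁` for `y = E x`, which variation
of constants solves (`eq_coreSol`).

Error: `σ(T) = M⁻¹`, so the exact solution consists of functions of `T` applied to vectors, and the
approximation uses the same functions of `H = Qᵀ T Q`. Both are Taylor series about `c₀` with the
same coefficients. The Krylov property makes all terms of degree below `m` agree
(`arnoldi_pow_mulVec`). For the rest, the numerical radii of `T - c₀` and of its compression `H -
c₀` are at most `ρ₀`, so the power inequality gives `‖(T - c₀)^j‖, ‖(H - c₀)^j‖ ≤ 2 ρ₀^j`
(`opNorm_pow_le_of_norm_inner_le`). With Cauchy's estimate for the coefficients on `Γ` the tail is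
geometric with ratio `ρ₀ / r`. -/

noncomputable section

namespace CArnoldi

/-! ### The numerical radius: power inequality and comparison with the operator norm. -/

section NumericalRadius
variable {E : Type*} [NormedAddCommGroup E] [InnerProductSpace ℂ E]

open scoped ComplexInnerProductSpace

/-- The positivity half of Berger's theorem: if `1 - ζ A` is accretive for every `ζ` in the unit
circle, then so is `1 - A ^ n`. -/
theorem re_inner_pow_le (A : E →L[ℂ] E) (hA : ∀ x, ‖⟪x, A x⟫‖ ≤ ‖x‖ ^ 2) {n : ℕ} (hn : n ≠ 0)
    (x : E) : (⟪x, (A ^ n) x⟫).re ≤ ‖x‖ ^ 2 := by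
  obtain ⟨ω, hω⟩ : ∃ ω : ℂ, IsPrimitiveRoot ω n := ⟨_, Complex.isPrimitiveRoot_exp n hn⟩
  have hω1 : ‖ω‖ = 1 := hω.norm'_eq_one hn
  -- These are partial Neumann sums `y j = ∑ₗ (ω^j A)^l x`. As `ω^j` is an `n`-th root of unity, `(1
  -- - ω^j A) (y j) = x - A^n x` for every `j`, while averaging over `j` leaves only `l = 0`. So `n
  -- ⟪x, x - A^n x⟫` is a sum of terms `⟪y j, (1 - ω^j A) (y j)⟫`, each with nonnegative real part.
  set y : ℕ → E := fun j => ∑ l ∈ Finset.range n, (ω ^ j) ^ l • (A ^ l) x with hy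
  have h1 : ∀ j, y j - ω ^ j • A (y j) = x - (A ^ n) x := by
    intro j
    have h := mul_neg_geom_sum ((ω ^ j) • A) n
    have h2 := congrArg (fun L : E →L[ℂ] E => L x) h
    have hn1 : (ω ^ j) ^ n = 1 := by rw [← pow_mul, mul_comm, pow_mul, hω.pow_eq_one, one_pow]
    simp only [smul_pow, hn1, one_smul] at h2
    simpa [y, sub_mul, _root_.sum_apply] using h2
  have h2 : ∑ j ∈ Finset.range n, y j = (n : ℂ) • x := by
    simp only [hy]
    rw [Finset.sum_comm]
    simp_rw [← Finset.sum_smul]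
    rw [Finset.sum_eq_single_of_mem 0 (Finset.mem_range.2 (Nat.pos_of_ne_zero hn))]
    · simp
    · intro l hl hl0
      have hne : ω ^ l ≠ 1 := hω.pow_ne_one_of_pos_of_lt hl0 (Finset.mem_range.1 hl)
      have hg := mul_neg_geom_sum (ω ^ l) n
      rw [← pow_mul, mul_comm l n, pow_mul, hω.pow_eq_one, one_pow, sub_self] at hg
      have h0 := (mul_eq_zero.1 hg).resolve_left (sub_ne_zero.2 hne.symm)
      have : ∑ j ∈ Finset.range n, (ω ^ j) ^ l = 0 := by
        rw [← h0]
        exact Finset.sum_congr rfl fun j _ => by rw [← pow_mul, mul_comm, pow_mul]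
      rw [this, zero_smul]
  have h3 : ∀ j, 0 ≤ (⟪y j, x - (A ^ n) x⟫).re := by
    intro j
    rw [← h1 j, inner_sub_right, inner_smul_right, Complex.sub_re, sub_nonneg]
    have h4 : (⟪y j, y j⟫).re = ‖y j‖ ^ 2 := by
      simpa using (inner_self_eq_norm_sq (𝕜 := ℂ) (y j))
    rw [h4]
    refine (Complex.re_le_norm _).trans ?_
    rw [norm_mul, norm_pow, hω1, one_pow, one_mul]
    exact hA _
  have h5 : 0 ≤ (⟪(n : ℂ) • x, x - (A ^ n) x⟫).re := by
    rw [← h2, sum_inner, Complex.re_sum]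
    exact Finset.sum_nonneg fun j _ => h3 j
  have h4 : (⟪x, x⟫).re = ‖x‖ ^ 2 := by
    simpa using (inner_self_eq_norm_sq (𝕜 := ℂ) x)
  have hn0 : (0 : ℝ) < n := Nat.cast_pos.2 (Nat.pos_of_ne_zero hn)
  rw [inner_smul_left, Complex.conj_natCast, ← Complex.ofReal_natCast, Complex.re_ofReal_mul,
    inner_sub_right, Complex.sub_re, h4] at h5
  have := nonneg_of_mul_nonneg_right h5 hn0
  linarith

theorem exists_norm_one_mul_eq_norm (z : ℂ) : ∃ e : ℂ, ‖e‖ = 1 ∧ e * z = ‖z‖ := by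
  rcases eq_or_ne z 0 with rfl | hz
  · exact ⟨1, by simp⟩
  · have h : (‖z‖ : ℂ) ≠ 0 := by simpa using hz
    refine ⟨‖z‖ / z, by simp [hz], by field_simp⟩

/-- The power inequality for the numerical radius. -/
theorem norm_inner_pow_le (A : E →L[ℂ] E) (hA : ∀ x, ‖⟪x, A x⟫‖ ≤ ‖x‖ ^ 2) (n : ℕ) (x : E) :
    ‖⟪x, (A ^ n) x⟫‖ ≤ ‖x‖ ^ 2 := by
  rcases eq_or_ne n 0 with rfl | hn
  · simp [inner_self_eq_norm_sq_to_K]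
  obtain ⟨e, he, hez⟩ := exists_norm_one_mul_eq_norm ⟪x, (A ^ n) x⟫
  -- Replacing `A` by `ζ A`, with `ζ` an `n`-th root of the phase, upgrades the real part to the
  -- modulus.
  obtain ⟨ζ, hζ⟩ := IsAlgClosed.exists_pow_nat_eq e (Nat.pos_of_ne_zero hn)
  have hζ1 : ‖ζ‖ = 1 := by
    rw [← pow_eq_one_iff_of_nonneg (norm_nonneg _) hn, ← norm_pow, hζ, he]
  have h := re_inner_pow_le (ζ • A) (fun y => by
    simpa [inner_smul_right, hζ1] using hA y) hn x
  rw [smul_pow, hζ, _root_.smul_apply, inner_smul_right, hez, Complex.ofReal_re] at h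
  exact h

/-- Polarization expresses `4 ⟪y, A x⟫` through four values of the quadratic form. For unit vectors
the parallelogram law, used twice, makes the squared norms sum to `8`, hence the factor `2`. -/
theorem opNorm_le_two_mul_of_norm_inner_le (A : E →L[ℂ] E) {ρ : ℝ} (hρ : 0 ≤ ρ)
    (hA : ∀ x, ‖⟪x, A x⟫‖ ≤ ρ * ‖x‖ ^ 2) : ‖A‖ ≤ 2 * ρ := by
  have key : ∀ x y : E, ‖x‖ = 1 → ‖y‖ = 1 → ‖⟪y, A x⟫‖ ≤ 2 * ρ := by
    intro x y hx hy
    have hpol : 4 * ⟪y, A x⟫ = ⟪x + y, A (x + y)⟫ - ⟪x - y, A (x - y)⟫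
        + Complex.I * ⟪x + Complex.I • y, A (x + Complex.I • y)⟫
        - Complex.I * ⟪x - Complex.I • y, A (x - Complex.I • y)⟫ := by
      simp only [map_add, map_sub, map_smul, inner_add_left, inner_add_right, inner_sub_left,
        inner_sub_right, inner_smul_left, inner_smul_right, Complex.conj_I]
      linear_combination (2 * ⟪y, A x⟫ - 2 * ⟪x, A y⟫) * Complex.I_sq
    have p1 := parallelogram_law_with_norm ℂ x y
    have p2 := parallelogram_law_with_norm ℂ x (Complex.I • y)
    have hIy : ‖Complex.I • y‖ = 1 := by simp [norm_smul, hy]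
    rw [hx, hy] at p1
    rw [hx, hIy] at p2
    have : ‖4 * ⟪y, A x⟫‖ ≤ ρ * ‖x + y‖ ^ 2 + ρ * ‖x - y‖ ^ 2 + ρ * ‖x + Complex.I • y‖ ^ 2
        + ρ * ‖x - Complex.I • y‖ ^ 2 := by
      rw [hpol]
      refine (norm_sub_le _ _).trans (add_le_add ((norm_add_le _ _).trans
        (add_le_add ((norm_sub_le _ _).trans (add_le_add (hA _) (hA _))) ?_)) ?_)
      · simpa using hA (x + Complex.I • y)
      · simpa using hA (x - Complex.I • y)
    rw [norm_mul, Complex.norm_ofNat] at this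
    nlinarith
  refine A.opNorm_le_bound (by positivity) fun x => ?_
  rcases eq_or_ne x 0 with rfl | hx
  · simp
  rcases eq_or_ne (A x) 0 with h0 | h0
  · rw [h0, norm_zero]; positivity
  have hx' : ‖x‖ ≠ 0 := norm_ne_zero_iff.2 hx
  have h0' : ‖A x‖ ≠ 0 := norm_ne_zero_iff.2 h0
  have h := key ((‖x‖⁻¹ : ℂ) • x) ((‖A x‖⁻¹ : ℂ) • A x) (by simp [norm_smul, hx'])
    (by simp [norm_smul, h0'])
  rw [map_smul, inner_smul_left, inner_smul_right, inner_self_eq_norm_sq_to_K, norm_mul, norm_mul]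
    at h
  simp only [RCLike.norm_conj, norm_inv, norm_pow, Complex.norm_real, norm_norm,
    Complex.coe_algebraMap] at h
  have e : ‖A x‖⁻¹ * (‖x‖⁻¹ * ‖A x‖ ^ 2) = ‖A x‖ / ‖x‖ := by field_simp
  rw [e, div_le_iff₀ (by positivity)] at h
  exact h

/-- Powers of an operator with numerical radius at most `ρ`. -/
theorem opNorm_pow_le_of_norm_inner_le (A : E →L[ℂ] E) {ρ : ℝ} (hρ : 0 < ρ)
    (hA : ∀ x, ‖⟪x, A x⟫‖ ≤ ρ * ‖x‖ ^ 2) (n : ℕ) : ‖A ^ n‖ ≤ 2 * ρ ^ n := by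
  have h := norm_inner_pow_le ((ρ⁻¹ : ℂ) • A) (fun x => by
    rw [_root_.smul_apply, inner_smul_right, norm_mul, norm_inv, Complex.norm_real,
      Real.norm_of_nonneg hρ.le, inv_mul_le_iff₀ hρ]
    exact hA x) n
  refine opNorm_le_two_mul_of_norm_inner_le _ (by positivity) fun x => ?_
  have h1 := h x
  rwa [smul_pow, _root_.smul_apply, inner_smul_right, norm_mul, norm_pow, norm_inv,
    Complex.norm_real, Real.norm_of_nonneg hρ.le, inv_pow, inv_mul_le_iff₀ (by positivity)] at h1

end NumericalRadius

/-! ### Cauchy coefficients on a circle. -/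

section CircleCoeff

open Metric

/-- The Cauchy coefficients `(2πi)⁻¹ ∮ (z - c)^(-j-1) h(z) dz`. -/
def circleCoeff (c : ℂ) (r : ℝ) (h : ℂ → ℂ) (j : ℕ) : ℂ :=
  (2 * Real.pi * Complex.I : ℂ)⁻¹ • ∮ z in C(c, r), ((z - c) ^ (j + 1))⁻¹ * h z

variable {c : ℂ} {r : ℝ}

theorem continuousOn_inv_sub_pow (hr : 0 < r) (j : ℕ) :
    ContinuousOn (fun z : ℂ => ((z - c) ^ j)⁻¹) (sphere c r) := by
  refine ContinuousOn.inv₀ (by fun_prop) fun z hz => pow_ne_zero _ (sub_ne_zero.2 ?_)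
  rintro rfl
  simp [hr.ne] at hz

theorem circleIntegrable_coeff (hr : 0 < r) {h : ℂ → ℂ} (hh : ContinuousOn h (sphere c r))
    (j : ℕ) : CircleIntegrable (fun z => ((z - c) ^ j)⁻¹ * h z) c r :=
  ((continuousOn_inv_sub_pow hr j).mul hh).circleIntegrable hr.le

theorem norm_circleCoeff_le (hr : 0 < r) {h : ℂ → ℂ} {M : ℝ} (hM : ∀ z ∈ sphere c r, ‖h z‖ ≤ M)
    (j : ℕ) : ‖circleCoeff c r h j‖ ≤ M / r ^ j := by
  have := circleIntegral.norm_two_pi_i_inv_smul_integral_le_of_norm_le_const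
    (f := fun z => ((z - c) ^ (j + 1))⁻¹ * h z) (c := c) (R := r) (C := M / r ^ (j + 1)) hr.le
    (fun z hz => by
      rw [norm_mul, norm_inv, norm_pow, mem_sphere_iff_norm.1 hz, div_eq_inv_mul]
      exact mul_le_mul_of_nonneg_left (hM z hz) (by positivity))
  refine this.trans_eq ?_
  rw [pow_succ]
  field_simp

theorem circleCoeff_congr (hr : 0 < r) {h k : ℂ → ℂ} (hk : Set.EqOn h k (sphere c r)) (j : ℕ) :
    circleCoeff c r h j = circleCoeff c r k j := by
  unfold circleCoeff
  rw [circleIntegral.integral_congr hr.le fun z hz => by rw [hk hz]]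

theorem circleCoeff_add (hr : 0 < r) {h k : ℂ → ℂ} (hh : ContinuousOn h (sphere c r))
    (hk : ContinuousOn k (sphere c r)) (j : ℕ) :
    circleCoeff c r (fun z => h z + k z) j = circleCoeff c r h j + circleCoeff c r k j := by
  unfold circleCoeff
  simp_rw [mul_add]
  rw [circleIntegral.integral_add (circleIntegrable_coeff hr hh _)
    (circleIntegrable_coeff hr hk _), smul_add]

theorem circleCoeff_const_mul (b : ℂ) (h : ℂ → ℂ) (j : ℕ) :
    circleCoeff c r (fun z => b * h z) j = b * circleCoeff c r h j := by
  unfold circleCoeff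
  simp_rw [mul_left_comm _ b]
  rw [circleIntegral.integral_const_mul, smul_eq_mul, smul_eq_mul, mul_left_comm]

theorem circleCoeff_one (hr : 0 < r) (j : ℕ) :
    circleCoeff c r (fun _ => 1) j = if j = 0 then 1 else 0 := by
  unfold circleCoeff
  simp_rw [mul_one]
  split_ifs with hj
  · subst hj
    simp only [zero_add, pow_one]
    rw [circleIntegral.integral_sub_center_inv _ hr.ne', smul_eq_mul, inv_mul_cancel₀]
    exact Complex.two_pi_I_ne_zero
  · have h := circleIntegral.integral_sub_zpow_of_ne (n := -((j + 1 : ℕ) : ℤ)) (by omega) c c r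
    simp only [_root_.zpow_neg, zpow_natCast] at h
    rw [h, smul_zero]

/-- Split `z = (z - c) + c`; the factor `z - c` lowers the order of the pole by one. -/
theorem circleCoeff_id_mul_succ (hr : 0 < r) {h : ℂ → ℂ} (hh : ContinuousOn h (sphere c r))
    (j : ℕ) : circleCoeff c r (fun z => z * h z) (j + 1)
      = circleCoeff c r h j + c * circleCoeff c r h (j + 1) := by
  rw [← circleCoeff_const_mul]
  unfold circleCoeff
  rw [← smul_add, ← circleIntegral.integral_add (circleIntegrable_coeff hr hh _)
    (circleIntegrable_coeff hr (continuousOn_const.fun_mul hh) _)]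
  congr 1
  refine circleIntegral.integral_congr hr.le fun z hz => ?_
  have : z - c ≠ 0 := by
    rw [← norm_ne_zero_iff, mem_sphere_iff_norm.1 hz]; exact hr.ne'
  field_simp
  ring

/-- Here the part with `z - c` cancels the pole and leaves `∮ h`, which vanishes by Cauchy's
theorem. This is where analyticity inside the circle enters. -/
theorem circleCoeff_id_mul_zero (hr : 0 < r) {h : ℂ → ℂ} (hh : DiffContOnCl ℂ h (ball c r)) :
    circleCoeff c r (fun z => z * h z) 0 = c * circleCoeff c r h 0 := by
  have hs : ContinuousOn h (sphere c r) := hh.continuousOn_ball.mono sphere_subset_closedBall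
  rw [← circleCoeff_const_mul]
  unfold circleCoeff
  have h0 : (∮ z in C(c, r), h z) = 0 := hh.circleIntegral_eq_zero hr.le
  rw [← zero_add (∮ z in C(c, r), ((z - c) ^ (0 + 1))⁻¹ * (c * h z)), ← h0,
    ← circleIntegral.integral_add (hs.circleIntegrable hr.le)
    (circleIntegrable_coeff hr (continuousOn_const.fun_mul hs) _)]
  congr 1
  refine circleIntegral.integral_congr hr.le fun z hz => ?_
  have : z - c ≠ 0 := by
    rw [← norm_ne_zero_iff, mem_sphere_iff_norm.1 hz]; exact hr.ne'
  field_simp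
  ring

end CircleCoeff

/-! ### Convergence of the `φ_k` series. -/

section PhiSeries

/-- Termwise domination by the exponential series. The field `𝕜` is kept apart from the real scalars
so that the lemma serves real and complex matrices alike. -/
theorem hasSum_phi (𝕜 : Type*) [RCLike 𝕜] {A : Type*} [NormedRing A] [NormedAlgebra 𝕜 A]
    [CompleteSpace A] [Algebra ℝ A] [IsScalarTower ℝ 𝕜 A] (k : ℕ) (a : A) :
    HasSum (fun j : ℕ => ((j + k).factorial : ℝ)⁻¹ • a ^ j) (phi k a) := by
  refine Summable.hasSum ?_
  refine (NormedSpace.norm_expSeries_summable' (𝕂 := 𝕜) a).of_norm_bounded fun j => ?_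
  rw [← algebraMap_smul 𝕜, norm_smul, norm_smul]
  gcongr
  rw [norm_algebraMap', norm_inv, norm_inv, RCLike.norm_natCast, RCLike.norm_natCast]
  gcongr
  omega

end PhiSeries

/-! ### A functional calculus by Taylor series about the centre of a disk. -/

section Calculus

open Metric

variable {A : Type*} [NormedRing A] [NormedAlgebra ℂ A]

/-- The series `∑ⱼ hⱼ (a - c)^j` with the Cauchy coefficients `hⱼ` of `h` on a circle. -/
def circleCalc (c : ℂ) (r : ℝ) (a : A) (h : ℂ → ℂ) : A :=
  ∑' j, circleCoeff c r h j • (a - algebraMap ℂ A c) ^ j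

variable {c : ℂ} {r ρ K : ℝ} {a : A}

theorem exists_norm_le_on_sphere {h : ℂ → ℂ} (hh : ContinuousOn h (sphere c r)) :
    ∃ M, ∀ z ∈ sphere c r, ‖h z‖ ≤ M :=
  (isCompact_sphere c r).exists_bound_of_continuousOn hh

theorem norm_circleCoeff_smul_le (hr : 0 < r)
    (ha : ∀ j, ‖(a - algebraMap ℂ A c) ^ j‖ ≤ K * ρ ^ j) {h : ℂ → ℂ} {M : ℝ}
    (hM : ∀ z ∈ sphere c r, ‖h z‖ ≤ M) (j : ℕ) :
    ‖circleCoeff c r h j • (a - algebraMap ℂ A c) ^ j‖ ≤ M * K * (ρ / r) ^ j := by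
  rw [norm_smul]
  refine (mul_le_mul (norm_circleCoeff_le hr hM j) (ha j) (norm_nonneg _)
    ((norm_nonneg _).trans (norm_circleCoeff_le hr hM j))).trans_eq ?_
  rw [div_pow]
  ring

theorem circleCalc_congr (hr : 0 < r) {h k : ℂ → ℂ} (hk : Set.EqOn h k (sphere c r)) :
    circleCalc c r a h = circleCalc c r a k := by
  unfold circleCalc
  simp_rw [circleCoeff_congr hr hk]

theorem circleCalc_one (hr : 0 < r) : circleCalc c r a (fun _ => 1) = 1 := by
  unfold circleCalc
  rw [tsum_eq_single 0 fun j hj => by rw [circleCoeff_one hr, if_neg hj, zero_smul]]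
  simp [circleCoeff_one hr]

theorem norm_circleCalc_le (hρ : 0 ≤ ρ) (hr : ρ < r)
    (ha : ∀ j, ‖(a - algebraMap ℂ A c) ^ j‖ ≤ K * ρ ^ j) {h : ℂ → ℂ} {M : ℝ}
    (hM : ∀ z ∈ sphere c r, ‖h z‖ ≤ M) :
    ‖circleCalc c r a h‖ ≤ M * K * (1 - ρ / r)⁻¹ := by
  have hr0 := hρ.trans_lt hr
  exact tsum_of_norm_bounded ((hasSum_geometric_of_lt_one (by positivity)
    ((div_lt_one hr0).2 hr)).mul_left _) (norm_circleCoeff_smul_le hr0 ha hM)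

variable [CompleteSpace A]

theorem hasSum_circleCalc (hρ : 0 ≤ ρ) (hr : ρ < r)
    (ha : ∀ j, ‖(a - algebraMap ℂ A c) ^ j‖ ≤ K * ρ ^ j) {h : ℂ → ℂ}
    (hh : ContinuousOn h (sphere c r)) :
    HasSum (fun j => circleCoeff c r h j • (a - algebraMap ℂ A c) ^ j) (circleCalc c r a h) := by
  obtain ⟨M, hM⟩ := exists_norm_le_on_sphere hh
  have hr0 := hρ.trans_lt hr
  exact (Summable.of_norm_bounded ((summable_geometric_of_lt_one (by positivity)
    ((div_lt_one hr0).2 hr)).mul_left _) (norm_circleCoeff_smul_le hr0 ha hM)).hasSum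

theorem circleCalc_add (hρ : 0 ≤ ρ) (hr : ρ < r)
    (ha : ∀ j, ‖(a - algebraMap ℂ A c) ^ j‖ ≤ K * ρ ^ j) {h k : ℂ → ℂ}
    (hh : ContinuousOn h (sphere c r)) (hk : ContinuousOn k (sphere c r)) :
    circleCalc c r a (fun z => h z + k z) = circleCalc c r a h + circleCalc c r a k := by
  rw [← ((hasSum_circleCalc hρ hr ha hh).add (hasSum_circleCalc hρ hr ha hk)).tsum_eq]
  unfold circleCalc
  simp_rw [circleCoeff_add (hρ.trans_lt hr) hh hk, add_smul]

theorem circleCalc_const_mul (b : ℂ) (hρ : 0 ≤ ρ) (hr : ρ < r)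
    (ha : ∀ j, ‖(a - algebraMap ℂ A c) ^ j‖ ≤ K * ρ ^ j) {h : ℂ → ℂ}
    (hh : ContinuousOn h (sphere c r)) :
    circleCalc c r a (fun z => b * h z) = b • circleCalc c r a h := by
  rw [← ((hasSum_circleCalc hρ hr ha hh).const_smul b).tsum_eq]
  unfold circleCalc
  simp_rw [circleCoeff_const_mul, mul_smul]

/-- Writing `a = (a - c) + c` reproduces the recursion of the coefficients under multiplication by
`z`. -/
theorem circleCalc_id_mul (hρ : 0 ≤ ρ) (hr : ρ < r)
    (ha : ∀ j, ‖(a - algebraMap ℂ A c) ^ j‖ ≤ K * ρ ^ j) {h : ℂ → ℂ}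
    (hh : DiffContOnCl ℂ h (ball c r)) :
    circleCalc c r a (fun z => z * h z) = a * circleCalc c r a h := by
  have hr0 := hρ.trans_lt hr
  have hs : ContinuousOn h (sphere c r) := hh.continuousOn_ball.mono sphere_subset_closedBall
  have h1 := hasSum_circleCalc hρ hr ha hs
  have h2 := hasSum_circleCalc hρ hr ha (h := fun z => z * h z) (continuousOn_id.mul hs)
  have h3 := h1.mul_left (a - algebraMap ℂ A c)
  -- The series of `(a - c)` times the calculus, reindexed by one; the value `0` at `j = 0` replaces
  -- the meaningless `j - 1`.
  have h4 : HasSum (fun j => (if j = 0 then 0 else circleCoeff c r h (j - 1) •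
      (a - algebraMap ℂ A c) ^ j)) ((a - algebraMap ℂ A c) * circleCalc c r a h) := by
    rw [← hasSum_nat_add_iff' 1]
    simpa [pow_succ', mul_smul_comm] using h3
  have h5 := h4.add (h1.const_smul c)
  have e : (fun j => (if j = 0 then 0 else circleCoeff c r h (j - 1) •
      (a - algebraMap ℂ A c) ^ j) + c • circleCoeff c r h j • (a - algebraMap ℂ A c) ^ j)
      = fun j => circleCoeff c r (fun z => z * h z) j • (a - algebraMap ℂ A c) ^ j := by
    funext j
    rcases j with _ | j
    · simp [circleCoeff_id_mul_zero hr0 hh, mul_smul]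
    · simp [circleCoeff_id_mul_succ hr0 hs, mul_smul, add_smul]
  rw [e] at h5
  rw [h2.unique h5, sub_mul, Algebra.smul_def]
  abel

theorem diffContOnCl_of_zero_notMem {h : ℂ → ℂ} (hh : DifferentiableOn ℂ h {0}ᶜ)
    (h0 : (0 : ℂ) ∉ closedBall c r) : DiffContOnCl ℂ h (ball c r) :=
  (hh.mono fun _ hz => by rintro rfl; exact h0 hz).diffContOnCl_ball subset_rfl

theorem differentiableOn_gInv (γ : ℝ) :
    DifferentiableOn ℂ (fun z : ℂ => gInv γ z) {0}ᶜ := by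
  unfold gInv
  exact ((differentiableOn_inv (𝕜 := ℂ)).sub_const 1).fun_const_smul _

/-- Since `z (z⁻¹ h) = h` on the circle and `z⁻¹ h` is analytic in a disk that avoids `0`,
multiplication by `a` sends the value at `z⁻¹ h` to the value at `h`. The left inverse `b` undoes
this. -/
theorem circleCalc_gInv_mul (hρ : 0 ≤ ρ) (hr : ρ < r)
    (h0 : (0 : ℂ) ∉ closedBall c r)
    (ha : ∀ j, ‖(a - algebraMap ℂ A c) ^ j‖ ≤ K * ρ ^ j) {b : A} (hb : b * a = 1) (γ : ℝ)
    {h : ℂ → ℂ} (hh : DifferentiableOn ℂ h {0}ᶜ) :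
    circleCalc c r a (fun z => gInv γ z * h z) = γ⁻¹ • (b - 1) * circleCalc c r a h := by
  have hr0 := hρ.trans_lt hr
  have hsub : sphere c r ⊆ ({0}ᶜ : Set ℂ) := fun z hz => by
    rintro rfl; exact h0 (sphere_subset_closedBall hz)
  have hi : DifferentiableOn ℂ (fun z => z⁻¹ * h z) {0}ᶜ := differentiableOn_inv.mul hh
  have h1 : a * circleCalc c r a (fun z => z⁻¹ * h z) = circleCalc c r a h := by
    rw [← circleCalc_id_mul hρ hr ha (diffContOnCl_of_zero_notMem hi h0)]
    exact circleCalc_congr hr0 fun z hz => mul_inv_cancel_left₀ (hsub hz) _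
  have h2 : circleCalc c r a (fun z => z⁻¹ * h z) = b * circleCalc c r a h := by
    rw [← h1, ← mul_assoc, hb, one_mul]
  have e : (fun z : ℂ => gInv γ z * h z)
      = fun z => (γ⁻¹ : ℝ) * (z⁻¹ * h z) + (-(γ⁻¹ : ℝ) : ℂ) * h z := by
    funext z
    simp only [gInv, Complex.real_smul]
    ring
  have hc1 := hi.continuousOn.mono hsub
  have hc2 := hh.continuousOn.mono hsub
  rw [e, circleCalc_add hρ hr ha (continuousOn_const.fun_mul hc1) (continuousOn_const.fun_mul hc2),
    circleCalc_const_mul _ hρ hr ha hc1, circleCalc_const_mul _ hρ hr ha hc2, h2,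
    ← Complex.coe_smul (γ⁻¹ : ℝ) (b - 1), smul_mul_assoc, sub_mul, one_mul, smul_sub, neg_smul,
    ← sub_eq_add_neg]

theorem circleCalc_gInv_pow (hρ : 0 ≤ ρ) (hr : ρ < r)
    (h0 : (0 : ℂ) ∉ closedBall c r)
    (ha : ∀ j, ‖(a - algebraMap ℂ A c) ^ j‖ ≤ K * ρ ^ j) {b : A} (hb : b * a = 1) (γ : ℝ)
    (l : ℕ) : circleCalc c r a (fun z => gInv γ z ^ l) = (γ⁻¹ • (b - 1)) ^ l := by
  induction l with
  | zero => simp only [pow_zero]; exact circleCalc_one (hρ.trans_lt hr)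
  | succ l ih =>
    simp only [pow_succ']
    rw [circleCalc_gInv_mul hρ hr h0 ha hb γ ((differentiableOn_gInv γ).fun_pow l), ih]

/-- The functions `σ^e φ_k(-t σ)` of `σ = gInv γ z`. -/
def gInvPhi {B : Type*} [Ring B] [Algebra ℝ B] [TopologicalSpace B] (e k : ℕ) (t : ℝ) (s : B) :
    B := s ^ e * phi k (-(t • s))

theorem hasSum_gInvPhi (𝕜 : Type*) [RCLike 𝕜] {B : Type*} [NormedRing B] [NormedAlgebra 𝕜 B]
    [CompleteSpace B] [Algebra ℝ B] [IsScalarTower ℝ 𝕜 B] (e k : ℕ) (t : ℝ) (s : B) :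
    HasSum (fun j : ℕ => (((j + k).factorial : ℝ)⁻¹ * (-t) ^ j) • s ^ (e + j))
      (gInvPhi e k t s) := by
  have h := (hasSum_phi 𝕜 k (-(t • s))).mul_left (s ^ e)
  refine h.congr_fun ?_
  intro j
  rw [← neg_smul, smul_pow, smul_smul, mul_smul_comm, pow_add]

theorem norm_gInvPhi_term_le {s : ℂ} {R : ℝ} (hs : ‖s‖ ≤ R) (e k j : ℕ) (t : ℝ) :
    ‖(((j + k).factorial : ℝ)⁻¹ * (-t) ^ j) • s ^ (e + j)‖
      ≤ R ^ e * ((|t| * R) ^ j / j.factorial) := by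
  have hR := (norm_nonneg s).trans hs
  rw [norm_smul, norm_mul, norm_pow, norm_pow, norm_neg, norm_inv, Real.norm_eq_abs t,
    Real.norm_natCast, mul_pow]
  calc ((j + k).factorial : ℝ)⁻¹ * |t| ^ j * ‖s‖ ^ (e + j)
      ≤ ((j).factorial : ℝ)⁻¹ * |t| ^ j * R ^ (e + j) := by
        gcongr
        omega
    _ = _ := by rw [pow_add]; ring

/-- Weierstrass M-test, `gInv γ` being bounded on the circle. Uniformity is what allows the calculus
to be passed to the limit. -/
theorem tendstoUniformlyOn_gInvPhi (h0 : (0 : ℂ) ∉ closedBall c r) (e k : ℕ) (γ t : ℝ) :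
    TendstoUniformlyOn (fun (L : ℕ) (z : ℂ) => ∑ j ∈ Finset.range L,
      (((j + k).factorial : ℝ)⁻¹ * (-t) ^ j) • gInv γ z ^ (e + j))
      (fun z => gInvPhi e k t (gInv γ z)) Filter.atTop (sphere c r) := by
  have hsub : sphere c r ⊆ ({0}ᶜ : Set ℂ) := fun z hz => by
    rintro rfl; exact h0 (sphere_subset_closedBall hz)
  obtain ⟨R, hR⟩ := exists_norm_le_on_sphere ((differentiableOn_gInv γ).continuousOn.mono hsub)
  have h := tendstoUniformlyOn_tsum_nat
    (f := fun (j : ℕ) (z : ℂ) => (((j + k).factorial : ℝ)⁻¹ * (-t) ^ j) • gInv γ z ^ (e + j))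
    ((Real.summable_pow_div_factorial (|t| * R)).mul_left (R ^ e))
    (s := sphere c r) fun j z hz => norm_gInvPhi_term_le (hR z hz) e k j t
  refine h.congr_right fun z _ => ?_
  exact (hasSum_gInvPhi ℂ e k t (gInv γ z)).tsum_eq

theorem continuousOn_gInv_pow (h0 : (0 : ℂ) ∉ closedBall c r) (γ : ℝ) (l : ℕ) :
    ContinuousOn (fun z : ℂ => gInv γ z ^ l) (sphere c r) :=
  ((differentiableOn_gInv γ).fun_pow l).continuousOn.mono fun z hz => by
    rintro rfl; exact h0 (sphere_subset_closedBall hz)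

theorem continuousOn_gInvPhi (h0 : (0 : ℂ) ∉ closedBall c r) (e k : ℕ) (γ t : ℝ) :
    ContinuousOn (fun z : ℂ => gInvPhi e k t (gInv γ z)) (sphere c r) :=
  (tendstoUniformlyOn_gInvPhi h0 e k γ t).continuousOn (Filter.Frequently.of_forall fun _ =>
    continuousOn_finsetSum _ fun _ _ => (continuousOn_gInv_pow h0 γ _).fun_const_smul _)

theorem circleCalc_sum_gInv (hρ : 0 ≤ ρ) (hr : ρ < r)
    (h0 : (0 : ℂ) ∉ closedBall c r)
    (ha : ∀ j, ‖(a - algebraMap ℂ A c) ^ j‖ ≤ K * ρ ^ j) {b : A} (hb : b * a = 1) (γ : ℝ)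
    (β : ℕ → ℝ) (e L : ℕ) :
    circleCalc c r a (fun z => ∑ j ∈ Finset.range L, β j • gInv γ z ^ (e + j))
      = ∑ j ∈ Finset.range L, β j • (γ⁻¹ • (b - 1)) ^ (e + j) := by
  induction L with
  | zero =>
    have := circleCalc_const_mul 0 hρ hr ha (h := fun _ => 1) continuousOn_const
    simpa using this
  | succ L ih =>
    simp only [Finset.sum_range_succ]
    rw [circleCalc_add hρ hr ha (continuousOn_finsetSum _ fun _ _ =>
      (continuousOn_gInv_pow h0 γ _).fun_const_smul _) ((continuousOn_gInv_pow h0 γ _).fun_const_smul _),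
      ih]
    simp_rw [Complex.real_smul]
    rw [circleCalc_const_mul _ hρ hr ha (continuousOn_gInv_pow h0 γ _),
      circleCalc_gInv_pow hρ hr h0 ha hb]
    rw [Complex.coe_smul]

/-- The Taylor series of `σ^e φ_k(-t σ)` about `c` represents the same function of `a`. -/
theorem hasSum_circleCoeff_gInvPhi (hρ : 0 ≤ ρ) (hr : ρ < r)
    (h0 : (0 : ℂ) ∉ closedBall c r)
    (ha : ∀ j, ‖(a - algebraMap ℂ A c) ^ j‖ ≤ K * ρ ^ j) {b : A} (hb : b * a = 1) (γ t : ℝ)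
    (e k : ℕ) :
    HasSum (fun j => circleCoeff c r (fun z => gInvPhi e k t (gInv γ z)) j •
      (a - algebraMap ℂ A c) ^ j) (gInvPhi e k t (γ⁻¹ • (b - 1))) := by
  have hcont := continuousOn_gInvPhi h0 e k γ t
  have hlim := (hasSum_gInvPhi ℂ e k t (γ⁻¹ • (b - 1))).tendsto_sum_nat
  convert hasSum_circleCalc hρ hr ha hcont
  refine tendsto_nhds_unique hlim ?_
  set p : ℕ → ℂ → ℂ := fun L z => ∑ j ∈ Finset.range L,
      (((j + k).factorial : ℝ)⁻¹ * (-t) ^ j) • gInv γ z ^ (e + j) with hp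
  have hpc : ∀ L, ContinuousOn (p L) (sphere c r) := fun L =>
    continuousOn_finsetSum _ fun _ _ => (continuousOn_gInv_pow h0 γ _).fun_const_smul _
  -- On the partial sum the calculus is already known to be substitution of `γ⁻¹ (b - 1)`; the
  -- remainder is controlled by its supremum on the circle.
  have hfp : ∀ L, circleCalc c r a (fun z => gInvPhi e k t (gInv γ z))
      = circleCalc c r a (p L)
        + circleCalc c r a (fun z => gInvPhi e k t (gInv γ z) - p L z) := by
    intro L
    rw [← circleCalc_add hρ hr ha (hpc L) (hcont.fun_sub (hpc L))]
    simp
  rw [Metric.tendsto_atTop]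
  intro ε hε
  have hr0 := hρ.trans_lt hr
  have hq : 0 < (1 - ρ / r)⁻¹ := inv_pos.2 (sub_pos.2 ((div_lt_one hr0).2 hr))
  have hK : 0 ≤ K := by simpa using (norm_nonneg _).trans (ha 0)
  -- `K (1 - ρ / r)⁻¹` bounds the calculus in terms of the supremum norm; the `+ 1` keeps the
  -- denominator positive and the final inequality strict.
  set δ := ε / (K * (1 - ρ / r)⁻¹ + 1) with hδ
  have hδ0 : 0 < δ := by positivity
  obtain ⟨L₀, hL₀⟩ := Filter.eventually_atTop.1
    (Metric.tendstoUniformlyOn_iff.1 (tendstoUniformlyOn_gInvPhi h0 e k γ t) δ hδ0)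
  refine ⟨L₀, fun L hL => ?_⟩
  rw [← circleCalc_sum_gInv hρ hr h0 ha hb γ (fun j => ((j + k).factorial : ℝ)⁻¹ * (-t) ^ j) e L,
    dist_eq_norm_sub', hfp L, add_sub_cancel_left]
  refine (norm_circleCalc_le hρ hr ha (M := δ) fun z hz => ?_).trans_lt ?_
  · rw [← dist_eq_norm]
    exact (hL₀ L hL z hz).le
  · rw [hδ, mul_assoc, div_mul_eq_mul_div, div_lt_iff₀ (by positivity)]
    nlinarith

end Calculus

/-! ### Real matrices acting on complex Euclidean space. -/

section Complexification

variable {l m n : Type*}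

/-- A real matrix as a complex matrix. -/
def toC (A : Matrix m n ℝ) : Matrix m n ℂ := A.map Complex.ofReal

theorem toC_mul [Fintype m] (A : Matrix l m ℝ) (B : Matrix m n ℝ) :
    toC (A * B) = toC A * toC B := Matrix.map_mul (f := Complex.ofRealHom)

theorem toC_one [DecidableEq n] : toC (1 : Matrix n n ℝ) = 1 :=
  Matrix.map_one _ Complex.ofReal_zero Complex.ofReal_one

theorem toC_sub (A B : Matrix m n ℝ) : toC (A - B) = toC A - toC B :=
  Matrix.map_sub _ Complex.ofReal_sub A B

theorem toC_smul (a : ℝ) (A : Matrix m n ℝ) : toC (a • A) = a • toC A := by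
  ext i j
  simp [toC]

theorem toC_pow [Fintype n] [DecidableEq n] (A : Matrix n n ℝ) (k : ℕ) :
    toC (A ^ k) = toC A ^ k := by
  induction k with
  | zero => simp [toC_one]
  | succ k ih => rw [pow_succ, pow_succ, toC_mul, ih]

theorem conjTranspose_toC (A : Matrix m n ℝ) : (toC A)ᴴ = toC Aᵀ := by
  ext i j
  simp [toC]

theorem toC_mulVec_ofReal [Fintype n] (A : Matrix m n ℝ) (v : n → ℝ) :
    toC A *ᵥ (fun i => (v i : ℂ)) = fun i => ((A *ᵥ v) i : ℂ) :=
  funext fun i => ((RingHom.map_mulVec Complex.ofRealHom A v i)).symm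

theorem continuous_toC : Continuous (toC : Matrix m n ℝ → Matrix m n ℂ) :=
  continuous_id.matrix_map Complex.continuous_ofReal

/-- `toC` as an additive map. -/
def toCAddHom : Matrix m n ℝ →+ Matrix m n ℂ where
  toFun := toC
  map_zero' := Matrix.map_zero _ Complex.ofReal_zero
  map_add' := Matrix.map_add _ Complex.ofReal_add

variable [Fintype m] [Fintype n]

open scoped ComplexInnerProductSpace

theorem inner_toLp_mulVec (x : m → ℂ) (A : Matrix m n ℂ) (y : n → ℂ) :
    ⟪WithLp.toLp 2 x, WithLp.toLp 2 (A *ᵥ y)⟫ = star x ⬝ᵥ (A *ᵥ y) := by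
  rw [EuclideanSpace.inner_toLp_toLp, dotProduct_comm]

theorem norm_toLp_ofReal (v : n → ℝ) :
    ‖WithLp.toLp 2 (fun i => (v i : ℂ))‖ = ‖WithLp.toLp 2 v‖ := by
  simp [EuclideanSpace.norm_eq]

theorem norm_toLp_mulVec_of_isometry [DecidableEq n] {Q : Matrix m n ℂ} (hQ : Qᴴ * Q = 1) (y : n → ℂ) :
    ‖WithLp.toLp 2 (Q *ᵥ y)‖ = ‖WithLp.toLp 2 y‖ := by
  have h : ⟪WithLp.toLp 2 (Q *ᵥ y), WithLp.toLp 2 (Q *ᵥ y)⟫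
      = ⟪WithLp.toLp 2 y, WithLp.toLp 2 y⟫ := by
    rw [inner_toLp_mulVec, star_mulVec, ← dotProduct_mulVec, mulVec_mulVec, hQ, one_mulVec,
      EuclideanSpace.inner_toLp_toLp, dotProduct_comm]
  rw [inner_self_eq_norm_sq_to_K, inner_self_eq_norm_sq_to_K] at h
  have h' : ‖WithLp.toLp 2 (Q *ᵥ y)‖ ^ 2 = ‖WithLp.toLp 2 y‖ ^ 2 := by exact_mod_cast h
  exact (sq_eq_sq₀ (norm_nonneg _) (norm_nonneg _)).1 h'

end Complexification

/-! ### Positive definite matrices without symmetry. -/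

section PosDef

variable {N : ℕ} {G : Matrix (Fin N) (Fin N) ℝ}

theorem PosDefNonsymm.isUnit_det (hG : PosDefNonsymm G) : IsUnit G.det := by
  rw [← isUnit_iff_isUnit_det, ← mulVec_injective_iff_isUnit]
  refine (injective_iff_map_eq_zero G.mulVecLin).2 fun v hv => ?_
  by_contra h
  have := hG v h
  rw [mulVecLin_apply] at hv
  simp [hv] at this

theorem PosDefNonsymm.mul_inv (hG : PosDefNonsymm G) : G * G⁻¹ = 1 :=
  mul_nonsing_inv _ hG.isUnit_det

theorem PosDefNonsymm.inv_mul (hG : PosDefNonsymm G) : G⁻¹ * G = 1 :=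
  nonsing_inv_mul _ hG.isUnit_det

/-- With `w = G⁻¹ v` the form `v ⬝ᵥ G⁻¹ v` becomes `w ⬝ᵥ G w`. -/
theorem PosDefNonsymm.inv (hG : PosDefNonsymm G) : PosDefNonsymm G⁻¹ := by
  intro v hv
  have hGv : G *ᵥ (G⁻¹ *ᵥ v) = v := by rw [mulVec_mulVec, hG.mul_inv, one_mulVec]
  have h0 : G⁻¹ *ᵥ v ≠ 0 := by
    intro h
    rw [h, mulVec_zero] at hGv
    exact hv hGv.symm
  have h := hG _ h0
  rwa [hGv, dotProduct_comm] at h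

/-- The right inverse of `E` makes `Eᵀ` injective. -/
theorem PosDefNonsymm.congr {n : ℕ} (hG : PosDefNonsymm G) {E : Matrix (Fin n) (Fin N) ℝ}
    {F : Matrix (Fin N) (Fin n) ℝ} (hEF : E * F = 1) : PosDefNonsymm (E * G * Eᵀ) := by
  intro v hv
  have h0 : Eᵀ *ᵥ v ≠ 0 := by
    intro h
    apply hv
    rw [← one_mulVec v, ← transpose_one, ← hEF, transpose_mul, ← mulVec_mulVec, h, mulVec_zero]
  have h := hG _ h0
  rwa [← mulVec_mulVec, ← mulVec_mulVec, dotProduct_mulVec, ← mulVec_transpose]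

theorem PosDefNonsymm.transpose_mul_self_add_smul {n : ℕ} (hG : PosDefNonsymm G) (E : Matrix (Fin n) (Fin N) ℝ)
    {γ : ℝ} (hγ : 0 < γ) : PosDefNonsymm (Eᵀ * E + γ • G) := by
  intro v hv
  rw [add_mulVec, dotProduct_add, smul_mulVec, dotProduct_smul, smul_eq_mul, ← mulVec_mulVec,
    dotProduct_mulVec, ← mulVec_transpose, transpose_transpose]
  have h1 := mul_pos hγ (hG v hv)
  have h2 : 0 ≤ E *ᵥ v ⬝ᵥ E *ᵥ v := by
    simpa using dotProduct_star_self_nonneg (E *ᵥ v)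
  linarith

theorem PosDefNonsymm.add_smul_one (hG : PosDefNonsymm G) {γ : ℝ} (hγ : 0 < γ) :
    PosDefNonsymm (G + γ • 1) := by
  intro v hv
  rw [add_mulVec, dotProduct_add, smul_mulVec, dotProduct_smul, smul_eq_mul, one_mulVec]
  have h2 : 0 ≤ v ⬝ᵥ v := by simpa using dotProduct_star_self_nonneg v
  have := hG v hv
  positivity

open scoped ComplexInnerProductSpace

/-- The cross terms between real and imaginary parts of `x` contribute only to the imaginary part,
even though `G` is not symmetric. -/
theorem PosDefNonsymm.re_inner_pos (hG : PosDefNonsymm G) {x : EuclideanSpace ℂ (Fin N)}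
    (hx : x ≠ 0) : 0 < (⟪x, toEuclideanCLM (𝕜 := ℂ) (toC G) x⟫).re := by
  obtain ⟨x⟩ := x
  rw [toEuclideanCLM_toLp, inner_toLp_mulVec]
  set a : Fin N → ℝ := fun i => (x i).re with ha
  set b : Fin N → ℝ := fun i => (x i).im with hb
  have h : (star x ⬝ᵥ (toC G *ᵥ x)).re = a ⬝ᵥ (G *ᵥ a) + b ⬝ᵥ (G *ᵥ b) := by
    simp only [dotProduct, mulVec, toC, Complex.re_sum, Complex.mul_re, Complex.im_sum, ha, hb,
      map_apply, Pi.star_apply, RCLike.star_def, Complex.conj_re, Complex.conj_im, Complex.mul_im,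
      Complex.ofReal_re, Complex.ofReal_im, zero_mul, sub_zero, add_zero, neg_mul, sub_neg_eq_add,
      Finset.sum_add_distrib]
  rw [h]
  have nonneg : ∀ v : Fin N → ℝ, 0 ≤ v ⬝ᵥ (G *ᵥ v) := fun v => by
    rcases eq_or_ne v 0 with rfl | hv
    · simp
    · exact (hG v hv).le
  by_cases h1 : a = 0
  · refine add_pos_of_nonneg_of_pos (nonneg a) (hG b fun h2 => hx ?_)
    congr 1
    funext i
    exact Complex.ext (congrFun h1 i) (congrFun h2 i)
  · exact add_pos_of_pos_of_nonneg (hG a h1) (nonneg b)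

end PosDef

/-! ### Operator norm disks and the Möbius map. -/

section NormDisk

open scoped ComplexInnerProductSpace

variable {E : Type*} [NormedAddCommGroup E] [InnerProductSpace ℂ E]

theorem norm_sub_ofReal_smul_sq (w x : E) (a : ℝ) :
    ‖w - (a : ℂ) • x‖ ^ 2 = ‖w‖ ^ 2 - 2 * a * (⟪x, w⟫).re + a ^ 2 * ‖x‖ ^ 2 := by
  have h1 : (⟪w, (a : ℂ) • x⟫).re = a * (⟪x, w⟫).re := by
    rw [inner_smul_right, Complex.re_ofReal_mul, ← inner_conj_symm, Complex.conj_re]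
  have h := norm_sub_sq (𝕜 := ℂ) w ((a : ℂ) • x)
  rw [RCLike.re_to_complex, h1, norm_smul, mul_pow, Complex.norm_real, Real.norm_eq_abs,
    sq_abs] at h
  linarith

/-- A coercive operator on a finite dimensional space lies in a disk, in the sense of the
operator norm, in the open right half plane. -/
theorem exists_norm_sub_smul_le [FiniteDimensional ℂ E] (A : E →L[ℂ] E)
    (hA : ∀ x, x ≠ 0 → 0 < (⟪x, A x⟫).re) :
    ∃ c ρ : ℝ, 0 < ρ ∧ ρ < c ∧ ∀ x, ‖A x - (c : ℂ) • x‖ ≤ ρ * ‖x‖ := by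
  have : ProperSpace E := FiniteDimensional.proper ℂ E
  obtain ⟨δ, hδ, hδA⟩ : ∃ δ : ℝ, 0 < δ ∧ ∀ x ∈ Metric.sphere (0 : E) 1, δ ≤ (⟪x, A x⟫).re :=
    (isCompact_sphere (0 : E) 1).exists_forall_le'
      (Complex.continuous_re.comp (continuous_id.inner A.continuous)).continuousOn
      fun x hx => hA x (ne_zero_of_mem_unit_sphere ⟨x, hx⟩)
  have hcoer : ∀ x, δ * ‖x‖ ^ 2 ≤ (⟪x, A x⟫).re := by
    intro x
    rcases eq_or_ne x 0 with rfl | hx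
    · simp
    have hx' : ‖x‖ ≠ 0 := norm_ne_zero_iff.2 hx
    have h := hδA (((‖x‖⁻¹ : ℝ) : ℂ) • x) (by simp [norm_smul, hx'])
    rw [map_smul, inner_smul_left, inner_smul_right, Complex.conj_ofReal, Complex.re_ofReal_mul,
      Complex.re_ofReal_mul, ← mul_assoc, ← mul_inv, ← sq, ← div_eq_inv_mul,
      le_div_iff₀ (by positivity)] at h
    exact h
  set R := ‖A‖
  -- Coercivity gives `‖A x - c x‖² ≤ (R² - 2 c δ + c²) ‖x‖²`, which is at most `(c - δ / 2)² ‖x‖²`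
  -- as soon as `c δ ≥ R² - δ² / 4`. Adding `δ²` to `R²` ensures `c ≥ δ`, so the radius is positive
  -- even if `R = 0`.
  refine ⟨(R ^ 2 + δ ^ 2) / δ, (R ^ 2 + δ ^ 2) / δ - δ / 2, ?_, by linarith, fun x => ?_⟩
  · rw [sub_pos, div_lt_div_iff₀ two_pos hδ]
    nlinarith [sq_nonneg R, sq_pos_of_pos hδ]
  set c := (R ^ 2 + δ ^ 2) / δ with hc
  have hcδ : c * δ = R ^ 2 + δ ^ 2 := by rw [hc]; field_simp
  have hρ : 0 ≤ c - δ / 2 := by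
    have : δ ≤ c := by rw [hc, le_div_iff₀ hδ]; nlinarith [sq_nonneg R]
    linarith
  have hc0 : 0 < c := by linarith
  refine (sq_le_sq₀ (norm_nonneg _) (by positivity)).1 ?_
  rw [norm_sub_ofReal_smul_sq, mul_pow]
  have h1 : ‖A x‖ ^ 2 ≤ R ^ 2 * ‖x‖ ^ 2 := by
    rw [← mul_pow]
    exact pow_le_pow_left₀ (norm_nonneg _) (A.le_opNorm x) 2
  have h2 := mul_le_mul_of_nonneg_left (hcoer x) (by linarith : 0 ≤ 2 * c)
  have h3 : 0 ≤ ‖x‖ ^ 2 := sq_nonneg _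
  nlinarith [mul_nonneg (sq_nonneg R) h3, mul_nonneg (sq_nonneg δ) h3]

theorem gMob_eq {γ μ : ℝ} (hγ : 0 < γ) (hμ : 0 < μ) : gMob γ μ = μ / (μ + γ) := by
  unfold gMob
  field_simp

theorem diskRadius_pos {γ c ρ : ℝ} (hγ : 0 < γ) (hρ : 0 < ρ) (hc : ρ < c) :
    0 < diskRadius γ c ρ := by
  have h1 : 0 < c - ρ := by linarith
  have h2 : 0 < c + ρ := by linarith
  rw [diskRadius, gMob_eq hγ h1, gMob_eq hγ h2]
  refine div_pos (sub_pos.2 ?_) two_pos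
  rw [div_lt_div_iff₀ (by linarith) (by linarith)]
  nlinarith

theorem diskRadius_lt_diskCentre {γ c ρ : ℝ} (hγ : 0 < γ) (hc : ρ < c) :
    diskRadius γ c ρ < diskCentre γ c ρ := by
  have h1 : 0 < c - ρ := by linarith
  have : 0 < gMob γ (c - ρ) := by rw [gMob_eq hγ h1]; positivity
  rw [diskRadius, diskCentre]
  linarith

theorem diskCentre_lt_one {γ c ρ : ℝ} (hγ : 0 < γ) (hρ : 0 < ρ) (hc : ρ < c) :
    diskCentre γ c ρ < 1 := by
  have key : ∀ μ, 0 < μ → gMob γ μ < 1 := fun μ hμ => by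
    rw [gMob_eq hγ hμ, div_lt_one (by linarith)]
    linarith
  have h1 := key (c - ρ) (by linarith)
  have h2 := key (c + ρ) (by linarith)
  rw [diskCentre]
  linarith

/-- The Möbius transformation `g` maps operator norm disks to operator norm disks. -/
theorem norm_sub_diskCentre_smul_le {γ c ρ : ℝ} (hγ : 0 < γ) (hρ : 0 < ρ) (hc : ρ < c) {w x : E}
    (h : ‖w - (c : ℂ) • x‖ ≤ ρ * ‖x‖) :
    ‖w - (diskCentre γ c ρ : ℂ) • (w + (γ : ℂ) • x)‖ ≤ diskRadius γ c ρ * ‖w + (γ : ℂ) • x‖ := by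
  have h1 : 0 < c - ρ := by linarith
  have h2 : 0 < c + ρ := by linarith
  have hr := diskRadius_pos hγ hρ hc
  refine (sq_le_sq₀ (norm_nonneg _) (by positivity)).1 ?_
  have h' := pow_le_pow_left₀ (norm_nonneg _) h 2
  have hγx : w + (γ : ℂ) • x = w - ((-γ : ℝ) : ℂ) • x := by simp
  rw [norm_sub_ofReal_smul_sq, mul_pow] at h'
  rw [norm_sub_ofReal_smul_sq, mul_pow, hγx, norm_sub_ofReal_smul_sq]
  have hin : (⟪w - ((-γ : ℝ) : ℂ) • x, w⟫).re = ‖w‖ ^ 2 + γ * (⟪x, w⟫).re := by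
    rw [inner_sub_left, inner_smul_left, Complex.conj_ofReal, Complex.sub_re,
      Complex.re_ofReal_mul]
    have : (⟪w, w⟫).re = ‖w‖ ^ 2 := by simpa using (inner_self_eq_norm_sq (𝕜 := ℂ) w)
    rw [this]
    ring
  rw [hin]
  set X := ‖x‖ ^ 2
  set Y := (⟪x, w⟫).re
  set Z := ‖w‖ ^ 2
  -- Squared and expanded, the defect of the image disk is exactly a positive multiple of the defect
  -- of the original one.
  have key : diskRadius γ c ρ ^ 2 * (Z - 2 * -γ * Y + (-γ) ^ 2 * X)
      - (Z - 2 * diskCentre γ c ρ * (Z + γ * Y) + diskCentre γ c ρ ^ 2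
        * (Z - 2 * -γ * Y + (-γ) ^ 2 * X))
      = γ ^ 2 / ((c - ρ + γ) * (c + ρ + γ)) * (ρ ^ 2 * X - (Z - 2 * c * Y + c ^ 2 * X)) := by
    rw [diskRadius, diskCentre, gMob_eq hγ h1, gMob_eq hγ h2]
    have e1 : c - ρ + γ ≠ 0 := by positivity
    have e2 : c + ρ + γ ≠ 0 := by positivity
    field_simp
    ring
  have : 0 ≤ γ ^ 2 / ((c - ρ + γ) * (c + ρ + γ)) * (ρ ^ 2 * X - (Z - 2 * c * Y + c ^ 2 * X)) :=
    mul_nonneg (by positivity) (sub_nonneg.2 h')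
  linarith

end NormDisk

/-! ### Reduction to Euclidean geometry on the range of `C`. -/

section Reduction

variable {N n : ℕ} {C G : Matrix (Fin N) (Fin N) ℝ} {VC : Matrix (Fin N) (Fin n) ℝ} {d : Fin n → ℝ}

/-- The factor `E` of `C = Eᵀ E`. -/
def factorE (VC : Matrix (Fin N) (Fin n) ℝ) (d : Fin n → ℝ) : Matrix (Fin n) (Fin N) ℝ :=
  diagonal (fun i => √(d i)) * VCᵀ

/-- The right inverse of `factorE`, with range the range of `C`. -/
def factorF (VC : Matrix (Fin N) (Fin n) ℝ) (d : Fin n → ℝ) : Matrix (Fin N) (Fin n) ℝ :=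
  VC * diagonal (fun i => (√(d i))⁻¹)

theorem IsEigenDecomposition.eq_transpose_mul (hV : IsEigenDecomposition C VC d) :
    C = (factorE VC d)ᵀ * factorE VC d := by
  rw [factorE, transpose_mul, transpose_transpose, diagonal_transpose, Matrix.mul_assoc,
    ← Matrix.mul_assoc (diagonal _) (diagonal _), diagonal_mul_diagonal, ← Matrix.mul_assoc]
  simp_rw [Real.mul_self_sqrt (hV.pos _).le]
  exact hV.eq

theorem diagonal_sqrt_mul_inv (hd : ∀ i, 0 < d i) :
    diagonal (fun i => √(d i)) * diagonal (fun i => (√(d i))⁻¹) = 1 := by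
  rw [diagonal_mul_diagonal, ← diagonal_one]
  congr 1
  funext i
  exact mul_inv_cancel₀ (Real.sqrt_pos.2 (hd i)).ne'

theorem diagonal_inv_mul_sqrt (hd : ∀ i, 0 < d i) :
    diagonal (fun i => (√(d i))⁻¹) * diagonal (fun i => √(d i)) = 1 := by
  rw [diagonal_mul_diagonal, ← diagonal_one]
  congr 1
  funext i
  exact inv_mul_cancel₀ (Real.sqrt_pos.2 (hd i)).ne'

theorem IsEigenDecomposition.factorE_mul_factorF (hV : IsEigenDecomposition C VC d) :
    factorE VC d * factorF VC d = 1 := by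
  rw [factorE, factorF, Matrix.mul_assoc, ← Matrix.mul_assoc _ VC, hV.orthonormal, Matrix.one_mul,
    diagonal_sqrt_mul_inv hV.pos]

theorem IsEigenDecomposition.factorF_mul_factorE (hV : IsEigenDecomposition C VC d) :
    factorF VC d * factorE VC d = rangeProj VC := by
  rw [factorE, factorF, Matrix.mul_assoc, ← Matrix.mul_assoc _ _ VCᵀ, diagonal_inv_mul_sqrt hV.pos, Matrix.one_mul,
    rangeProj]

/-- The matrix `M = E G⁻¹ Eᵀ`, similar to `B₁₁`. -/
def coreM (G : Matrix (Fin N) (Fin N) ℝ) (E : Matrix (Fin n) (Fin N) ℝ) :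
    Matrix (Fin n) (Fin n) ℝ := E * G⁻¹ * Eᵀ

/-- The matrix `T = (M + γ)⁻¹ M`, similar to the restriction of `S` to the range of `C`. -/
def coreT (G : Matrix (Fin N) (Fin N) ℝ) (E : Matrix (Fin n) (Fin N) ℝ) (γ : ℝ) :
    Matrix (Fin n) (Fin n) ℝ := (coreM G E + γ • 1)⁻¹ * coreM G E

theorem IsEigenDecomposition.posDefNonsymm_coreM (hV : IsEigenDecomposition C VC d)
    (hG : PosDefNonsymm G) : PosDefNonsymm (coreM G (factorE VC d)) :=
  hG.inv.congr hV.factorE_mul_factorF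

theorem IsEigenDecomposition.factorE_mul_opB (hV : IsEigenDecomposition C VC d) :
    factorE VC d * opB C G = coreM G (factorE VC d) * factorE VC d := by
  rw [opB, coreM, Matrix.mul_assoc _ _ (factorE VC d), ← hV.eq_transpose_mul, Matrix.mul_assoc]

/-- The source is `(M + γ) E = E G⁻¹ (C + γ G)`. The projection disappears because `P_C = F E` and
`E F = 1`. -/
theorem IsEigenDecomposition.factorE_mul_opS (hV : IsEigenDecomposition C VC d)
    (hG : PosDefNonsymm G) {γ : ℝ} (hγ : 0 < γ) :
    factorE VC d * opS C G VC γ = coreT G (factorE VC d) γ * factorE VC d := by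
  set E := factorE VC d with hE
  have hC : C = Eᵀ * E := hV.eq_transpose_mul
  have hCG : PosDefNonsymm (C + γ • G) := by rw [hC]; exact hG.transpose_mul_self_add_smul E hγ
  have hM : PosDefNonsymm (coreM G E + γ • 1) := (hV.posDefNonsymm_coreM hG).add_smul_one hγ
  have h1 : (coreM G E + γ • 1) * E = E * G⁻¹ * (C + γ • G) := by
    rw [Matrix.add_mul, Matrix.mul_add, Matrix.mul_smul, Matrix.mul_assoc E G⁻¹ G, hG.inv_mul, Matrix.mul_one,
      Matrix.smul_mul, Matrix.one_mul, coreM, hC, ← Matrix.mul_assoc (E * G⁻¹)]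
  have h2 : (coreM G E + γ • 1) * (E * (C + γ • G)⁻¹ * C) = coreM G E * E := by
    rw [Matrix.mul_assoc E, ← Matrix.mul_assoc _ E, h1, Matrix.mul_assoc (E * G⁻¹), ← Matrix.mul_assoc _ _ C, hCG.mul_inv,
      Matrix.one_mul, coreM, hC, ← Matrix.mul_assoc (E * G⁻¹)]
  rw [opS, ← hV.factorF_mul_factorE, ← hE, coreT, Matrix.mul_assoc _ _ E, ← h2, ← Matrix.mul_assoc _ _ (_ * C),
    hM.inv_mul, Matrix.one_mul, ← Matrix.mul_assoc, ← Matrix.mul_assoc, ← Matrix.mul_assoc, hV.factorE_mul_factorF, Matrix.one_mul]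

theorem IsEigenDecomposition.cNorm_eq (hV : IsEigenDecomposition C VC d) (v : Fin N → ℝ) :
    cNorm C v = ‖WithLp.toLp 2 (factorE VC d *ᵥ v)‖ := by
  rw [cNorm, hV.eq_transpose_mul, ← mulVec_mulVec, dotProduct_mulVec, ← mulVec_transpose,
    transpose_transpose, EuclideanSpace.norm_eq]
  simp [dotProduct, sq]

open scoped ComplexInnerProductSpace

/-- The map `x ↦ E x` takes the vectors with `x^* C x = 1` onto the unit sphere, the right inverse
`factorF` giving surjectivity. -/
theorem IsEigenDecomposition.mem_cNumericalRange_iff (hV : IsEigenDecomposition C VC d)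
    {A : Matrix (Fin N) (Fin N) ℝ} {T : Matrix (Fin n) (Fin n) ℝ}
    (hA : factorE VC d * A = T * factorE VC d) (z : ℂ) :
    z ∈ cNumericalRange C A ↔ ∃ y : EuclideanSpace ℂ (Fin n), ‖y‖ = 1 ∧
      z = ⟪y, toEuclideanCLM (𝕜 := ℂ) (toC T) y⟫ := by
  set E := factorE VC d with hE
  have hC : C = Eᵀ * E := hV.eq_transpose_mul
  have h1 : ∀ x : Fin N → ℂ, star x ⬝ᵥ ((C.map Complex.ofReal) *ᵥ x)
      = ((‖WithLp.toLp 2 (toC E *ᵥ x)‖ ^ 2 : ℝ) : ℂ) := by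
    intro x
    have := inner_self_eq_norm_sq_to_K (𝕜 := ℂ) (WithLp.toLp 2 (toC E *ᵥ x))
    rw [inner_toLp_mulVec, star_mulVec, ← dotProduct_mulVec, mulVec_mulVec, conjTranspose_toC,
      ← toC_mul, ← hC] at this
    simpa [toC] using this
  have h2 : ∀ x : Fin N → ℂ, star x ⬝ᵥ (((C * A).map Complex.ofReal) *ᵥ x)
      = ⟪WithLp.toLp 2 (toC E *ᵥ x),
        toEuclideanCLM (𝕜 := ℂ) (toC T) (WithLp.toLp 2 (toC E *ᵥ x))⟫ := by
    intro x
    rw [toEuclideanCLM_toLp, inner_toLp_mulVec, star_mulVec, ← dotProduct_mulVec, mulVec_mulVec,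
      mulVec_mulVec, conjTranspose_toC, ← toC_mul, ← toC_mul, Matrix.mul_assoc, ← hA, ← Matrix.mul_assoc, ← hC]
    rfl
  constructor
  · rintro ⟨x, hx, rfl⟩
    refine ⟨_, ?_, h2 x⟩
    rw [h1 x, Complex.ofReal_eq_one] at hx
    exact (pow_eq_one_iff_of_nonneg (norm_nonneg _) two_ne_zero).1 hx
  · rintro ⟨⟨y⟩, hy, rfl⟩
    have hy' : toC E *ᵥ (toC (factorF VC d) *ᵥ y) = y := by
      rw [mulVec_mulVec, ← toC_mul, hV.factorE_mul_factorF, toC_one, one_mulVec]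
    refine ⟨toC (factorF VC d) *ᵥ y, ?_, ?_⟩
    · rw [h1, hy', hy]
      simp
    · rw [h2, hy']

theorem IsEigenDecomposition.norm_inner_sub_le (hV : IsEigenDecomposition C VC d)
    {A : Matrix (Fin N) (Fin N) ℝ} {T : Matrix (Fin n) (Fin n) ℝ}
    (hA : factorE VC d * A = T * factorE VC d) {c : ℂ} {ρ : ℝ}
    (h : cNumericalRange C A ⊆ Metric.closedBall c ρ) (y : EuclideanSpace ℂ (Fin n)) :
    ‖⟪y, toEuclideanCLM (𝕜 := ℂ) (toC T - algebraMap ℂ _ c) y⟫‖ ≤ ρ * ‖y‖ ^ 2 := by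
  rcases eq_or_ne y 0 with rfl | hy
  · simp
  have hy' : ‖y‖ ≠ 0 := norm_ne_zero_iff.2 hy
  set u : EuclideanSpace ℂ (Fin n) := ((‖y‖⁻¹ : ℝ) : ℂ) • y with hu
  have hu1 : ‖u‖ = 1 := by simp [hu, norm_smul, hy']
  have h1 := h ((hV.mem_cNumericalRange_iff hA _).2 ⟨u, hu1, rfl⟩)
  have hyu : y = (‖y‖ : ℂ) • u := by
    rw [hu, smul_smul, ← Complex.ofReal_mul, mul_inv_cancel₀ hy', Complex.ofReal_one, one_smul]
  rw [mem_closedBall_iff_norm] at h1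
  have h2 : ⟪u, toEuclideanCLM (𝕜 := ℂ) (toC T - algebraMap ℂ _ c) u⟫
      = ⟪u, toEuclideanCLM (𝕜 := ℂ) (toC T) u⟫ - c := by
    rw [map_sub, AlgHomClass.commutes, _root_.sub_apply, inner_sub_right,
      Algebra.algebraMap_eq_smul_one, _root_.smul_apply, inner_smul_right,
      one_apply_eq_self, inner_self_eq_norm_sq_to_K, hu1]
    simp
  rw [hyu, map_smul, inner_smul_left, inner_smul_right, Complex.conj_ofReal, h2, norm_mul,
    norm_mul, norm_smul, hu1, Complex.norm_real, norm_norm, mul_one, ← mul_assoc, ← sq, mul_comm]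
  gcongr

theorem cNumericalRange_subset_of_norm_le (hV : IsEigenDecomposition C VC d)
    {A : Matrix (Fin N) (Fin N) ℝ} {T : Matrix (Fin n) (Fin n) ℝ}
    (hA : factorE VC d * A = T * factorE VC d) {c : ℂ} {ρ : ℝ}
    (h : ∀ y, ‖toEuclideanCLM (𝕜 := ℂ) (toC T) y - c • y‖ ≤ ρ * ‖y‖) :
    cNumericalRange C A ⊆ Metric.closedBall c ρ := by
  intro z hz
  obtain ⟨y, hy, rfl⟩ := (hV.mem_cNumericalRange_iff hA z).1 hz
  rw [mem_closedBall_iff_norm]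
  have : ⟪y, toEuclideanCLM (𝕜 := ℂ) (toC T) y⟫ - c
      = ⟪y, toEuclideanCLM (𝕜 := ℂ) (toC T) y - c • y⟫ := by
    rw [inner_sub_right, inner_smul_right, inner_self_eq_norm_sq_to_K, hy]
    simp
  rw [this]
  refine (norm_inner_le_norm _ _).trans ?_
  rw [hy, one_mul]
  have := h y
  rwa [hy, mul_one] at this

/-- The disks for `B` and for `S`. -/
theorem exists_disk (hV : IsEigenDecomposition C VC d) (hG : PosDefNonsymm G) :
    ∃ c₁ ρ₁ : ℝ, 0 < ρ₁ ∧ ρ₁ < c₁ ∧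
      cNumericalRange C (opB C G) ⊆ Metric.closedBall (c₁ : ℂ) ρ₁ ∧
      ∀ γ : ℝ, 0 < γ →
        0 < diskRadius γ c₁ ρ₁ ∧ diskRadius γ c₁ ρ₁ < diskCentre γ c₁ ρ₁ ∧
        diskCentre γ c₁ ρ₁ < 1 ∧
        cNumericalRange C (opS C G VC γ) ⊆
          Metric.closedBall (diskCentre γ c₁ ρ₁ : ℂ) (diskRadius γ c₁ ρ₁) := by
  set E := factorE VC d with hE
  have hM := hV.posDefNonsymm_coreM hG
  obtain ⟨c, ρ, hρ, hc, h⟩ := exists_norm_sub_smul_le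
    (toEuclideanCLM (𝕜 := ℂ) (toC (coreM G E))) fun x hx => hM.re_inner_pos hx
  refine ⟨c, ρ, hρ, hc, cNumericalRange_subset_of_norm_le hV hV.factorE_mul_opB h, fun γ hγ =>
    ⟨diskRadius_pos hγ hρ hc, diskRadius_lt_diskCentre hγ hc, diskCentre_lt_one hγ hρ hc,
    cNumericalRange_subset_of_norm_le hV (hV.factorE_mul_opS hG hγ) fun y => ?_⟩⟩
  have hMγ := hM.add_smul_one hγ
  have hcomm : coreT G E γ * (coreM G E + γ • 1) = coreM G E := by
    have : Commute (coreM G E + γ • 1) (coreM G E) := by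
      refine (Commute.refl _).add_left ?_
      exact (Commute.one_left _).smul_left γ
    rw [coreT, Matrix.mul_assoc, ← this.eq, ← Matrix.mul_assoc, hMγ.inv_mul, Matrix.one_mul]
  -- With `x = (M + γ)⁻¹ y` one has `y = M x + γ x` and `T y = M x`, the form required by the Möbius
  -- estimate with `w = M x`.
  set x := toEuclideanCLM (𝕜 := ℂ) (toC (coreM G E + γ • 1)⁻¹) y with hx
  have hy : y = toEuclideanCLM (𝕜 := ℂ) (toC (coreM G E)) x + (γ : ℂ) • x := by
    have e1 : toEuclideanCLM (𝕜 := ℂ) (toC (coreM G E + γ • 1)) x = y := by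
      rw [hx, ← mul_apply_eq_comp, ← map_mul, ← toC_mul, hMγ.mul_inv, toC_one, map_one,
        one_apply_eq_self]
    have e2 : toC (coreM G E + γ • 1) = toC (coreM G E) + (γ : ℂ) • 1 := by
      rw [← toC_one, Complex.coe_smul, ← toC_smul]
      exact toCAddHom.map_add _ _
    rw [← e1, e2, map_add, map_smul, map_one]
    rfl
  have hT : toEuclideanCLM (𝕜 := ℂ) (toC (coreT G E γ)) y
      = toEuclideanCLM (𝕜 := ℂ) (toC (coreM G E)) x := by
    rw [hx, ← mul_apply_eq_comp, ← map_mul, ← toC_mul]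
    congr 3
    calc _ = coreT G E γ * ((coreM G E + γ • 1) * (coreM G E + γ • 1)⁻¹) := by
          rw [hMγ.mul_inv, Matrix.mul_one]
      _ = _ := by rw [← Matrix.mul_assoc, hcomm]
  have := norm_sub_diskCentre_smul_le hγ hρ hc (h x)
  rwa [← hy, ← hT] at this

end Reduction

/-! ### The functions `φ_k` of a matrix. -/

section PhiMatrix

open scoped Matrix.Norms.L2Operator

variable {n : ℕ}

theorem phi_conj {X Y : Matrix (Fin n) (Fin n) ℝ} (hXY : X * Y = 1) (k : ℕ)
    (A : Matrix (Fin n) (Fin n) ℝ) : phi k (X * A * Y) = X * phi k A * Y := by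
  have hYX : Y * X = 1 := mul_eq_one_comm.1 hXY
  have hpow : ∀ j, (X * A * Y) ^ j = X * A ^ j * Y := by
    intro j
    induction j with
    | zero => simp [hXY]
    | succ j ih =>
      calc _ = X * A ^ j * (Y * X) * A * Y := by rw [pow_succ, ih]; simp only [mul_assoc]
        _ = _ := by rw [hYX, mul_one, pow_succ]; simp only [mul_assoc]
  have h := ((hasSum_phi ℝ k A).mul_left X).mul_right Y
  refine (hasSum_phi ℝ k (X * A * Y)).unique ?_
  simpa only [hpow, mul_smul_comm, smul_mul_assoc] using h

theorem mul_phi_succ (k : ℕ) (A : Matrix (Fin n) (Fin n) ℝ) :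
    A * phi (k + 1) A = phi k A - (k.factorial : ℝ)⁻¹ • (1 : Matrix (Fin n) (Fin n) ℝ) := by
  have h1 := (hasSum_phi ℝ (k + 1) A).mul_left A
  have h2 := (hasSum_nat_add_iff' 1).2 (hasSum_phi ℝ k A)
  simp only [Finset.range_one, Finset.sum_singleton, zero_add, pow_zero] at h2
  simp only [mul_smul_comm, ← pow_succ'] at h1
  refine h1.unique ?_
  simpa only [add_assoc, add_comm 1 k] using h2

theorem phi_zero_eq_exp (A : Matrix (Fin n) (Fin n) ℝ) : phi 0 A = NormedSpace.exp A := by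
  rw [NormedSpace.exp_eq_tsum ℝ]
  simp only [phi, add_zero]

/-- `T⁻¹ = M⁻¹ (M + γ) = 1 + γ M⁻¹`. This lets functions of `T` represent the exact solution. -/
theorem gInv_coreT {N : ℕ} {G : Matrix (Fin N) (Fin N) ℝ} {E : Matrix (Fin n) (Fin N) ℝ}
    (hM : PosDefNonsymm (coreM G E)) {γ : ℝ} (hγ : 0 < γ) :
    gInv γ (coreT G E γ) = (coreM G E)⁻¹ := by
  have h : (coreT G E γ)⁻¹ = 1 + γ • (coreM G E)⁻¹ := by
    refine inv_eq_right_inv ?_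
    have e : coreM G E * (1 + γ • (coreM G E)⁻¹) = coreM G E + γ • 1 := by
      rw [mul_add, mul_one, mul_smul_comm, hM.mul_inv]
    rw [coreT, mul_assoc, e, (hM.add_smul_one hγ).inv_mul]
  rw [gInv, h, add_sub_cancel_left, smul_smul, inv_mul_cancel₀ hγ.ne', one_smul]

end PhiMatrix

/-! ### The range component of the differential algebraic system. -/

section RangeComponent

variable {N n : ℕ} {C G : Matrix (Fin N) (Fin N) ℝ} {VC : Matrix (Fin N) (Fin n) ℝ} {d : Fin n → ℝ}

/-- The range component in coordinates: `φ₀(-tL) a + t L φ₁(-tL) b₀ + t² L φ₂(-tL) b₁`. -/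
def coreSol (L : Matrix (Fin n) (Fin n) ℝ) (t : ℝ) (a b₀ b₁ : Fin n → ℝ) : Fin n → ℝ :=
  phi 0 (-(t • L)) *ᵥ a + t • ((L * phi 1 (-(t • L))) *ᵥ b₀)
    + t ^ 2 • ((L * phi 2 (-(t • L))) *ᵥ b₁)

/-- `B₁₁` is similar to `M` through the diagonal matrix of the `√(d i)`, and inverses and `φ_k`
respect similarity. -/
theorem xR_eq (hV : IsEigenDecomposition C VC d) (hG : PosDefNonsymm G) (t : ℝ)
    (x₀ u₀ u₁ : Fin N → ℝ) :
    xR C G VC t x₀ u₀ u₁ = factorF VC d *ᵥ coreSol (coreM G (factorE VC d))⁻¹ t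
      (factorE VC d *ᵥ x₀) (factorE VC d *ᵥ (G⁻¹ *ᵥ u₀)) (factorE VC d *ᵥ (G⁻¹ *ᵥ u₁)) := by
  set X : Matrix (Fin n) (Fin n) ℝ := diagonal (fun i => (√(d i))⁻¹) with hX
  set Y : Matrix (Fin n) (Fin n) ℝ := diagonal (fun i => √(d i)) with hY
  set E := factorE VC d with hE
  set M := coreM G E with hM
  have hYX : Y * X = 1 := diagonal_sqrt_mul_inv hV.pos
  have hXY : X * Y = 1 := diagonal_inv_mul_sqrt hV.pos
  have hEV : E * VC = Y := by rw [hE, factorE, Matrix.mul_assoc, hV.orthonormal, Matrix.mul_one]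
  have hXE : X * E = VCᵀ := by rw [hE, factorE, ← Matrix.mul_assoc, hXY, Matrix.one_mul]
  have hMM : M * M⁻¹ = 1 := (hV.posDefNonsymm_coreM hG).mul_inv
  have hB : opB11 C G VC = X * M * Y := by
    rw [opB11, opB, hV.eq_transpose_mul, ← hE, ← hXE, hM, coreM, ← hEV]
    simp only [Matrix.mul_assoc]
  have hL : (opB11 C G VC)⁻¹ = X * M⁻¹ * Y := by
    refine inv_eq_right_inv ?_
    calc _ = X * M * (Y * X) * M⁻¹ * Y := by rw [hB]; simp only [Matrix.mul_assoc]
      _ = 1 := by rw [hYX, Matrix.mul_one, Matrix.mul_assoc X, hMM, Matrix.mul_one, hXY]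
  have hphi : ∀ k, phi k (-(t • (opB11 C G VC)⁻¹)) = X * phi k (-(t • M⁻¹)) * Y := by
    intro k
    rw [← phi_conj hXY, hL]
    congr 1
    rw [Matrix.mul_neg, Matrix.neg_mul, Matrix.mul_smul, Matrix.smul_mul]
  have h0 : ∀ Z : Matrix (Fin n) (Fin n) ℝ,
      VC * (X * Z * Y) * VCᵀ = factorF VC d * Z * E := by
    intro Z
    rw [factorF, ← hX, hE, factorE, ← hY]
    simp only [Matrix.mul_assoc]
  have h1 : ∀ k, VC * (opB11 C G VC)⁻¹ * phi k (-(t • (opB11 C G VC)⁻¹)) * VCᵀ * G⁻¹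
      = factorF VC d * (M⁻¹ * phi k (-(t • M⁻¹))) * E * G⁻¹ := by
    intro k
    rw [← h0, hphi, hL]
    congr 2
    calc _ = VC * X * M⁻¹ * (Y * X) * phi k (-(t • M⁻¹)) * Y := by simp only [Matrix.mul_assoc]
      _ = _ := by rw [hYX, Matrix.mul_one]; simp only [Matrix.mul_assoc]
  rw [xR, h1, h1, hphi, h0, coreSol]
  simp only [mulVec_add, mulVec_smul, mulVec_mulVec, Matrix.mul_assoc]

/-- The solution formula for `y' = L (b₀ + s b₁ - y)`. -/
theorem eq_coreSol {L M : Matrix (Fin n) (Fin n) ℝ} (hLM : L * M = 1) {y y' : ℝ → Fin n → ℝ}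
    {b₀ b₁ : Fin n → ℝ}
    (hy : ∀ s : ℝ, 0 ≤ s → HasDerivWithinAt y (y' s) (Set.Ici 0) s ∧
      y' s = L *ᵥ (b₀ + s • b₁ - y s)) {t : ℝ} (ht : 0 ≤ t) :
    y t = coreSol L t (y 0) b₀ b₁ := by
  have hML : M * L = 1 := mul_eq_one_comm.1 hLM
  -- Subtracting the particular solution `b₀ + s b₁ - M b₁` leaves the homogeneous equation `w' = -L
  -- w`.
  set w : ℝ → Fin n → ℝ := fun s => y s - b₀ - s • b₁ + M *ᵥ b₁ with hw
  have hw' : ∀ s, 0 ≤ s → HasDerivWithinAt w (-(L *ᵥ w s)) (Set.Ici 0) s := by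
    intro s hs
    have h := (((hy s hs).1.sub_const b₀).sub
      ((hasDerivAt_id s).smul_const b₁).hasDerivWithinAt).add_const (M *ᵥ b₁)
    refine h.congr_deriv ?_
    rw [(hy s hs).2, hw]
    simp only [mulVec_add, mulVec_sub, mulVec_mulVec, hLM, one_mulVec, one_smul]
    abel
  have hexp : ∀ s, HasDerivAt (fun s : ℝ => NormedSpace.exp (s • L))
      (NormedSpace.exp (s • L) * L) s := by
    open scoped Matrix.Norms.L2Operator in
    exact fun s => hasDerivAt_exp_smul_const L s
  have hv : ∀ s, 0 ≤ s → HasDerivWithinAt (fun s => NormedSpace.exp (s • L) *ᵥ w s) 0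
      (Set.Ici 0) s := by
    intro s hs
    rw [hasDerivWithinAt_pi]
    intro i
    simp only [mulVec, dotProduct]
    have h1 : ∀ j, HasDerivAt (fun s : ℝ => NormedSpace.exp (s • L) i j)
        ((NormedSpace.exp (s • L) * L) i j) s := fun j =>
      hasDerivAt_pi.1 (hasDerivAt_pi.1 (hexp s) i) j
    have h2 := HasDerivWithinAt.fun_sum (u := Finset.univ) fun j _ =>
      ((h1 j).hasDerivWithinAt (s := Set.Ici 0)).mul (hasDerivWithinAt_pi.1 (hw' s hs) j)
    refine h2.congr_deriv ?_
    rw [Finset.sum_add_distrib]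
    have e1 : ∑ j, (NormedSpace.exp (s • L) * L) i j * w s j
        = (NormedSpace.exp (s • L) *ᵥ (L *ᵥ w s)) i := by rw [mulVec_mulVec]; rfl
    have e2 : ∑ j, NormedSpace.exp (s • L) i j * (-(L *ᵥ w s)) j
        = -(NormedSpace.exp (s • L) *ᵥ (L *ᵥ w s)) i := by
      exact congrFun (mulVec_neg (L *ᵥ w s) (NormedSpace.exp (s • L))) i
    rw [e1, e2, add_neg_cancel]
    rfl
  have hconst : NormedSpace.exp (t • L) *ᵥ w t = w 0 := by
    have h := constant_of_has_deriv_right_zero (a := 0) (b := t)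
      (fun s hs => ((hv s hs.1).continuousWithinAt).mono Set.Icc_subset_Ici_self)
      (fun s hs => (hv s hs.1).mono (Set.Ici_subset_Ici.2 hs.1)) t ⟨ht, le_rfl⟩
    simpa using h
  have hwt : w t = phi 0 (-(t • L)) *ᵥ w 0 := by
    rw [phi_zero_eq_exp, ← hconst, mulVec_mulVec, ← Matrix.exp_add_of_commute _ _
      (Commute.refl (t • L)).neg_left, 
      neg_add_cancel, NormedSpace.exp_zero, one_mulVec]
  -- The recursion for `φ_k` reduces everything to `φ_0`, so that the formula becomes a linear
  -- identity in `φ_0(-t L)`.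
  have hp1 : t • (L * phi 1 (-(t • L))) = 1 - phi 0 (-(t • L)) := by
    have h := mul_phi_succ 0 (-(t • L))
    rw [zero_add, neg_mul, smul_mul_assoc, Nat.factorial_zero, Nat.cast_one, inv_one, one_smul] at h
    rw [← neg_sub, ← h, neg_neg]
  have hp2 : t ^ 2 • (L * phi 2 (-(t • L))) = t • 1 - M * (1 - phi 0 (-(t • L))) := by
    have h := mul_phi_succ 1 (-(t • L))
    rw [neg_mul, smul_mul_assoc, Nat.factorial_one, Nat.cast_one, inv_one, one_smul] at h
    rw [← hp1, mul_smul_comm, ← mul_assoc, hML, one_mul, sq, mul_smul, ← smul_sub, ← neg_sub (phi _ _), ← h,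
      neg_neg]
  have hyt : y t = w t + b₀ + t • b₁ - M *ᵥ b₁ := by simp only [hw]; abel
  have hw0 : w 0 = y 0 - b₀ + M *ᵥ b₁ := by simp [hw]
  have hcomm : M * phi 0 (-(t • L)) = phi 0 (-(t • L)) * M := by
    have h := phi_conj hML 0 (-(t • L))
    have e : M * -(t • L) * L = -(t • L) := by
      rw [mul_neg, mul_smul_comm, hML, neg_mul, smul_mul_assoc, one_mul]
    rw [e] at h
    conv_rhs => rw [h]
    rw [mul_assoc, hLM, mul_one]
  rw [hyt, hwt, hw0, coreSol, ← smul_mulVec, ← smul_mulVec, hp1, hp2]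
  simp only [mulVec_add, mulVec_sub, sub_mulVec, mul_sub, mul_one, mulVec_mulVec, hcomm,
    one_mulVec, smul_mulVec]
  abel

/-- Multiplying the system by `E G⁻¹` and using `E G⁻¹ C = M E` gives a closed equation for `E x`;
the component of `x` in the kernel of `C` drops out. -/
theorem rangeProj_mulVec_eq_xR (hV : IsEigenDecomposition C VC d) (hG : PosDefNonsymm G)
    (x x' : ℝ → Fin N → ℝ) (u₀ u₁ : Fin N → ℝ)
    (h : ∀ s : ℝ, 0 ≤ s → HasDerivWithinAt x (x' s) (Set.Ici 0) s ∧
      C *ᵥ x' s + G *ᵥ x s = u₀ + s • u₁) {t : ℝ} (ht : 0 ≤ t) :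
    rangeProj VC *ᵥ x t = xR C G VC t (x 0) u₀ u₁ := by
  set E := factorE VC d with hE
  set M := coreM G E with hM
  have hMp : PosDefNonsymm M := hV.posDefNonsymm_coreM hG
  rw [xR_eq hV hG, ← hV.factorF_mul_factorE, ← mulVec_mulVec]
  congr 1
  refine eq_coreSol hMp.inv_mul (y := fun s => E *ᵥ x s) (y' := fun s => E *ᵥ x' s)
    (fun s hs => ⟨?_, ?_⟩) ht
  · exact (LinearMap.toContinuousLinearMap E.mulVecLin).hasFDerivAt.comp_hasDerivWithinAt s
      (h s hs).1
  · have h1 : E *ᵥ (G⁻¹ *ᵥ (C *ᵥ x' s + G *ᵥ x s)) = M *ᵥ (E *ᵥ x' s) + E *ᵥ x s := by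
      have hEB : E * (G⁻¹ * C) = M * E := hV.factorE_mul_opB
      simp only [mulVec_add, mulVec_mulVec, hG.inv_mul, Matrix.mul_one, hEB]
    rw [(h s hs).2] at h1
    have h2 : E *ᵥ (G⁻¹ *ᵥ u₀) + s • E *ᵥ (G⁻¹ *ᵥ u₁) - E *ᵥ x s = M *ᵥ (E *ᵥ x' s) := by
      rw [← sub_eq_iff_eq_add.2 h1]
      simp only [mulVec_add, mulVec_smul]
    rw [h2, mulVec_mulVec, hMp.inv_mul, one_mulVec]

end RangeComponent

/-! ### Numerical range disks for real matrices and their functions. -/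

section NumericalRangeMatrix

open scoped ComplexInnerProductSpace Matrix.Norms.L2Operator

variable {n k : ℕ}

/-- The numerical range of the real matrix `A` lies in the disk with centre `c` and radius `ρ`. -/
def NumRangeLE (A : Matrix (Fin n) (Fin n) ℝ) (c ρ : ℝ) : Prop :=
  ∀ y : EuclideanSpace ℂ (Fin n),
    ‖⟪y, toEuclideanCLM (𝕜 := ℂ) (toC A - algebraMap ℂ _ (c : ℂ)) y⟫‖ ≤ ρ * ‖y‖ ^ 2

theorem NumRangeLE.norm_pow_le {A : Matrix (Fin n) (Fin n) ℝ} {c ρ : ℝ} (h : NumRangeLE A c ρ)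
    (hρ : 0 < ρ) (j : ℕ) :
    ‖(toC A - algebraMap ℂ (Matrix (Fin n) (Fin n) ℂ) (c : ℂ)) ^ j‖ ≤ 2 * ρ ^ j := by
  rw [cstar_norm_def, map_pow]
  exact opNorm_pow_le_of_norm_inner_le _ hρ h j

theorem NumRangeLE.norm_pow_mulVec_le {A : Matrix (Fin n) (Fin n) ℝ} {c ρ : ℝ}
    (h : NumRangeLE A c ρ) (hρ : 0 < ρ) (j : ℕ) (y : Fin n → ℂ) :
    ‖WithLp.toLp 2 ((toC A - algebraMap ℂ (Matrix (Fin n) (Fin n) ℂ) (c : ℂ)) ^ j *ᵥ y)‖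
      ≤ 2 * ρ ^ j * ‖WithLp.toLp 2 y‖ :=
  (l2_opNorm_mulVec _ (WithLp.toLp 2 y)).trans
    (mul_le_mul_of_nonneg_right (h.norm_pow_le hρ j) (norm_nonneg _))

/-- On a kernel vector the hypothesis reads `c ‖v‖² ≤ ρ ‖v‖²`, and `ρ < c`. -/
theorem NumRangeLE.isUnit_det {A : Matrix (Fin n) (Fin n) ℝ} {c ρ : ℝ} (h : NumRangeLE A c ρ)
    (hρ : 0 < ρ) (hc : ρ < c) : IsUnit A.det := by
  rw [← isUnit_iff_isUnit_det, ← mulVec_injective_iff_isUnit]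
  refine (injective_iff_map_eq_zero A.mulVecLin).2 fun v hv => ?_
  rw [mulVecLin_apply] at hv
  have h1 := h (WithLp.toLp 2 fun i => (v i : ℂ))
  have h0 : toC A *ᵥ (fun i => (v i : ℂ)) = 0 := by
    rw [toC_mulVec_ofReal, hv]
    simp
    rfl
  rw [toEuclideanCLM_toLp, sub_mulVec, h0, zero_sub, Algebra.algebraMap_eq_smul_one, smul_mulVec,
    one_mulVec, ← neg_smul, WithLp.toLp_smul, inner_smul_right, inner_self_eq_norm_sq_to_K,
    norm_mul, norm_neg, norm_pow, norm_toLp_ofReal] at h1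
  simp only [Complex.norm_real, Complex.coe_algebraMap, norm_norm] at h1
  rw [Real.norm_of_nonneg (hρ.trans hc).le] at h1
  have h2 : ‖WithLp.toLp 2 v‖ ^ 2 ≤ 0 := by
    by_contra hpos
    nlinarith
  have h3 : WithLp.toLp 2 v = 0 := by
    rw [← norm_eq_zero]
    exact pow_eq_zero_iff two_ne_zero |>.1 (le_antisymm h2 (sq_nonneg _))
  exact (WithLp.toLp_eq_zero 2).1 h3

/-- The form of `Qᵀ A Q` at `y` is that of `A` at `Q y`, which has the same norm. Hence the
Hessenberg matrices inherit the disk of `T`. -/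
theorem NumRangeLE.compress {A : Matrix (Fin n) (Fin n) ℝ} {c ρ : ℝ} (h : NumRangeLE A c ρ)
    {Q : Matrix (Fin n) (Fin k) ℝ} (hQ : Qᵀ * Q = 1) : NumRangeLE (Qᵀ * A * Q) c ρ := by
  rintro ⟨y⟩
  have hQ' : (toC Q)ᴴ * toC Q = 1 := by rw [conjTranspose_toC, ← toC_mul, hQ, toC_one]
  have h1 := h (WithLp.toLp 2 (toC Q *ᵥ y))
  rw [norm_toLp_mulVec_of_isometry hQ', toEuclideanCLM_toLp, inner_toLp_mulVec, star_mulVec,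
    ← dotProduct_mulVec, mulVec_mulVec, mulVec_mulVec] at h1
  rw [toEuclideanCLM_toLp, inner_toLp_mulVec]
  have e : toC (Qᵀ * A * Q) - algebraMap ℂ (Matrix (Fin k) (Fin k) ℂ) (c : ℂ)
      = (toC Q)ᴴ * (toC A - algebraMap ℂ (Matrix (Fin n) (Fin n) ℂ) (c : ℂ)) * toC Q := by
    rw [Matrix.mul_sub, Matrix.sub_mul, toC_mul, toC_mul, ← conjTranspose_toC,
      Algebra.algebraMap_eq_smul_one, Algebra.algebraMap_eq_smul_one, Matrix.mul_smul,
      Matrix.mul_one, Matrix.smul_mul, hQ']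
  rwa [e]

theorem toC_gInvPhi (e l : ℕ) (t : ℝ) (A : Matrix (Fin n) (Fin n) ℝ) :
    toC (gInvPhi e l t A) = gInvPhi e l t (toC A) := by
  have h1 := (hasSum_gInvPhi ℝ e l t A).map toCAddHom continuous_toC
  refine h1.unique ((hasSum_gInvPhi ℂ e l t (toC A)).congr_fun ?_)
  intro j
  change toC _ = _
  rw [toC_smul, toC_pow]

theorem zero_notMem_closedBall {c r : ℝ} (hr : 0 < r) (hc : r < c) :
    (0 : ℂ) ∉ Metric.closedBall (c : ℂ) r := by
  rw [mem_closedBall_iff_norm, zero_sub, norm_neg, Complex.norm_real, Real.norm_of_nonneg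
    (hr.trans hc).le, not_le]
  exact hc

theorem NumRangeLE.hasSum_gInvPhi {A : Matrix (Fin n) (Fin n) ℝ} {c ρ r : ℝ}
    (h : NumRangeLE A c ρ) (hρ : 0 < ρ) (hr : ρ < r) (hc : r < c) (γ t : ℝ) (e l : ℕ) :
    HasSum (fun j => circleCoeff c r (fun z => gInvPhi e l t (gInv γ z)) j •
      (toC A - algebraMap ℂ (Matrix (Fin n) (Fin n) ℂ) (c : ℂ)) ^ j)
      (toC (gInvPhi e l t (gInv γ A))) := by
  have hinv : toC A⁻¹ * toC A = 1 := by
    rw [← toC_mul, nonsing_inv_mul _ (h.isUnit_det hρ (hr.trans hc)), toC_one]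
  have h1 := hasSum_circleCoeff_gInvPhi hρ.le hr (zero_notMem_closedBall (hρ.trans hr) hc)
    (h.norm_pow_le hρ) hinv γ t e l
  have e : toC (gInv γ A) = γ⁻¹ • (toC A⁻¹ - 1) := by rw [gInv, toC_smul, toC_sub, toC_one]
  rwa [toC_gInvPhi, e]

theorem norm_toLp_conjTranspose_mulVec_le {Q : Matrix (Fin n) (Fin k) ℂ} (hQ : Qᴴ * Q = 1)
    (b : Fin n → ℂ) : ‖WithLp.toLp 2 (Qᴴ *ᵥ b)‖ ≤ ‖WithLp.toLp 2 b‖ := by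
  have h1 : ⟪WithLp.toLp 2 (Qᴴ *ᵥ b), WithLp.toLp 2 (Qᴴ *ᵥ b)⟫
      = ⟪WithLp.toLp 2 (Q *ᵥ (Qᴴ *ᵥ b)), WithLp.toLp 2 b⟫ := by
    rw [inner_toLp_mulVec, EuclideanSpace.inner_toLp_toLp, star_mulVec Q, dotProduct_comm b,
      dotProduct_mulVec]
  rw [inner_self_eq_norm_sq_to_K] at h1
  have h2 := norm_inner_le_norm (𝕜 := ℂ) (WithLp.toLp 2 (Q *ᵥ (Qᴴ *ᵥ b))) (WithLp.toLp 2 b)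
  rw [← h1, norm_toLp_mulVec_of_isometry hQ, norm_pow] at h2
  simp only [Complex.norm_real, Complex.coe_algebraMap, norm_norm] at h2
  rcases (norm_nonneg (WithLp.toLp 2 (Qᴴ *ᵥ b))).eq_or_lt with h0 | h0
  · rw [← h0]
    exact norm_nonneg _
  · rw [sq] at h2
    exact le_of_mul_le_mul_left h2 h0

end NumericalRangeMatrix

/-! ### The Krylov structure of the Arnoldi iteration. -/

section Krylov

variable {N n m k : ℕ}

/-- Each multiplication by a Hessenberg matrix extends the support of a vector by at most one index.
-/
theorem hessenberg_pow_apply {H : Matrix (Fin k) (Fin k) ℝ}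
    (hH : ∀ i j : Fin k, (j : ℕ) + 1 < i → H i j = 0) (c : ℝ) {i₀ : Fin k} (h0 : (i₀ : ℕ) = 0)
    (j : ℕ) (i : Fin k) (hi : j < i) :
    ((H - c • (1 : Matrix (Fin k) (Fin k) ℝ)) ^ j *ᵥ Pi.single i₀ 1) i = 0 := by
  induction j generalizing i with
  | zero =>
    have : i ≠ i₀ := by rintro rfl; omega
    simp [this]
  | succ j ih =>
    rw [pow_succ', ← mulVec_mulVec, mulVec, dotProduct]
    refine Finset.sum_eq_zero fun a _ => ?_
    rcases lt_or_ge j (a : ℕ) with ha | ha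
    · rw [ih a ha, mul_zero]
    · have hne : i ≠ a := by rintro rfl; omega
      rw [Matrix.sub_apply, hH i a (by omega), Matrix.smul_apply, one_apply_ne hne, smul_zero, sub_zero,
        zero_mul]

/-- Exactness of the Arnoldi projection on powers below `m`. -/
theorem arnoldi_pow_mulVec {T : Matrix (Fin n) (Fin n) ℝ} {Q : Matrix (Fin n) (Fin k) ℝ}
    {H : Matrix (Fin k) (Fin k) ℝ} {q : Fin n → ℝ}
    (hH : ∀ i j : Fin k, (j : ℕ) + 1 < i → H i j = 0) (hkm : k ≤ m) (hq : k < m → q = 0)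
    (hrec : T * Q = Q * H + Matrix.of (fun a (j : Fin k) => if (j : ℕ) + 1 = k then q a else 0))
    (c : ℝ) {i₀ : Fin k} (h0 : (i₀ : ℕ) = 0) (j : ℕ) (hj : j < m) :
    (T - c • (1 : Matrix (Fin n) (Fin n) ℝ)) ^ j *ᵥ (Q *ᵥ Pi.single i₀ 1)
      = Q *ᵥ ((H - c • (1 : Matrix (Fin k) (Fin k) ℝ)) ^ j *ᵥ Pi.single i₀ 1) := by
  induction j with
  | zero => rw [pow_zero, pow_zero, one_mulVec, one_mulVec]
  | succ j ih =>
    rw [pow_succ', ← mulVec_mulVec, ih (by omega), pow_succ' (H - _), ← mulVec_mulVec]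
    set y := (H - c • (1 : Matrix (Fin k) (Fin k) ℝ)) ^ j *ᵥ Pi.single i₀ 1 with hy
    -- The residual sees only the last entry of `y`, of index `k - 1`. After a breakdown `q = 0`;
    -- otherwise `k = m`, and `j + 1 < m` puts that entry outside the support of `y`.
    have hz : Matrix.of (fun a (j : Fin k) => if (j : ℕ) + 1 = k then q a else 0) *ᵥ y = 0 := by
      funext a
      rw [mulVec, dotProduct]
      refine Finset.sum_eq_zero fun i _ => ?_
      rw [of_apply]
      split_ifs with hi
      · rcases hkm.lt_or_eq with hlt | heq
        · rw [hq hlt, Pi.zero_apply, zero_mul]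
        · rw [hy, hessenberg_pow_apply hH c h0 j i (by omega), mul_zero]
      · rw [zero_mul]
    clear_value y
    rw [mulVec_mulVec, Matrix.sub_mul, hrec, Matrix.smul_mul, Matrix.one_mul, sub_mulVec,
      add_mulVec, hz, add_zero, mulVec_mulVec, Matrix.mul_sub, sub_mulVec, Matrix.mul_smul,
      Matrix.mul_one]

variable {C G : Matrix (Fin N) (Fin N) ℝ} {VC : Matrix (Fin N) (Fin n) ℝ} {d : Fin n → ℝ} {γ : ℝ}
  {v : Fin N → ℝ} {W : Matrix (Fin N) (Fin k) ℝ} {H : Matrix (Fin k) (Fin k) ℝ}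

theorem IsArnoldi.transpose_mul_self (hV : IsEigenDecomposition C VC d) {S P}
    (hA : IsArnoldi C S P v m k W H) : (factorE VC d * W)ᵀ * (factorE VC d * W) = 1 := by
  rw [transpose_mul, Matrix.mul_assoc, ← Matrix.mul_assoc _ _ W, ← hV.eq_transpose_mul,
    ← Matrix.mul_assoc, hA.orthonormal]

theorem IsArnoldi.exists_recurrence (hV : IsEigenDecomposition C VC d) (hG : PosDefNonsymm G)
    (hγ : 0 < γ) {P} (hA : IsArnoldi C (opS C G VC γ) P v m k W H) :
    ∃ q : Fin n → ℝ, (factorE VC d * W)ᵀ *ᵥ q = 0 ∧ (k < m → q = 0) ∧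
      coreT G (factorE VC d) γ * (factorE VC d * W) = factorE VC d * W * H
        + Matrix.of (fun a (j : Fin k) => if (j : ℕ) + 1 = k then q a else 0) := by
  obtain ⟨q, h1, h2, h3⟩ := hA.recurrence
  refine ⟨factorE VC d *ᵥ q, ?_, fun h => by rw [h2 h, mulVec_zero], ?_⟩
  · rw [transpose_mul, ← mulVec_mulVec, mulVec_mulVec _ _ (factorE VC d), ← hV.eq_transpose_mul, h1]
  · rw [← Matrix.mul_assoc, ← hV.factorE_mul_opS hG hγ, Matrix.mul_assoc, h3, Matrix.mul_add,
      Matrix.mul_assoc]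
    congr 1
    ext a j
    rw [mul_apply, of_apply]
    simp only [of_apply]
    split_ifs with h
    · rfl
    · simp

/-- Multiply the transported recurrence by `Qᵀ`: the residual is orthogonal to the columns of `Q`.
-/
theorem IsArnoldi.eq_compress (hV : IsEigenDecomposition C VC d) (hG : PosDefNonsymm G)
    (hγ : 0 < γ) {P} (hA : IsArnoldi C (opS C G VC γ) P v m k W H) :
    H = (factorE VC d * W)ᵀ * coreT G (factorE VC d) γ * (factorE VC d * W) := by
  obtain ⟨q, h1, -, h3⟩ := hA.exists_recurrence hV hG hγ
  rw [Matrix.mul_assoc, h3, Matrix.mul_add, ← Matrix.mul_assoc, hA.transpose_mul_self hV,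
    Matrix.one_mul, left_eq_add]
  ext a j
  rw [mul_apply]
  simp only [of_apply]
  split_ifs with h
  · exact congrFun h1 a
  · simp

/-- Exactness of the Arnoldi projection, applied to the starting vector. -/
theorem IsArnoldi.pow_mulVec_eq (hV : IsEigenDecomposition C VC d) (hG : PosDefNonsymm G)
    (hγ : 0 < γ) (hA : IsArnoldi C (opS C G VC γ) (rangeProj VC) v m k W H) (c : ℝ) {j : ℕ}
    (hj : j < m) :
    (coreT G (factorE VC d) γ - c • (1 : Matrix (Fin n) (Fin n) ℝ)) ^ j *ᵥ (factorE VC d *ᵥ v)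
      = (factorE VC d * W) *ᵥ ((H - c • (1 : Matrix (Fin k) (Fin k) ℝ)) ^ j *ᵥ
        ((factorE VC d * W)ᵀ *ᵥ (factorE VC d *ᵥ v))) := by
  have hEP : factorE VC d *ᵥ v = factorE VC d *ᵥ (rangeProj VC *ᵥ v) := by
    rw [← hV.factorF_mul_factorE, mulVec_mulVec, ← Matrix.mul_assoc, hV.factorE_mul_factorF,
      Matrix.one_mul]
  rcases Nat.eq_zero_or_pos k with hk | hk
  · rw [hEP, hA.start_zero hk]
    simp only [mulVec_zero]
  · have hb : factorE VC d *ᵥ v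
        = cNorm C v • ((factorE VC d * W) *ᵥ Pi.single (⟨0, hk⟩ : Fin k) 1) := by
      rw [hEP, hA.start ⟨0, hk⟩ rfl, mulVec_smul, ← mulVec_mulVec, mulVec_single_one]
    obtain ⟨q, -, h2, h3⟩ := hA.exists_recurrence hV hG hγ
    rw [hb, mulVec_smul, mulVec_smul, mulVec_mulVec _ (factorE VC d * W)ᵀ,
      hA.transpose_mul_self hV, one_mulVec, mulVec_smul, mulVec_smul,
      arnoldi_pow_mulVec hA.hessenberg hA.dim_le h2 h3 c rfl j hj]

end Krylov

/-! ### The error of a single Arnoldi approximation. -/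

section ErrorBound

variable {N n m k : ℕ} {C G : Matrix (Fin N) (Fin N) ℝ} {VC : Matrix (Fin N) (Fin n) ℝ}
  {d : Fin n → ℝ} {γ : ℝ} {v : Fin N → ℝ} {W : Matrix (Fin N) (Fin k) ℝ}
  {H : Matrix (Fin k) (Fin k) ℝ}

theorem toC_sub_algebraMap_pow {n : ℕ} (A : Matrix (Fin n) (Fin n) ℝ) (c : ℝ) (j : ℕ) :
    (toC A - algebraMap ℂ (Matrix (Fin n) (Fin n) ℂ) (c : ℂ)) ^ j
      = toC ((A - c • (1 : Matrix (Fin n) (Fin n) ℝ)) ^ j) := by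
  rw [toC_pow, toC_sub, toC_smul, toC_one, Algebra.algebraMap_eq_smul_one, Complex.coe_smul]

/-- The error of one Arnoldi approximation as a Taylor series whose first `m` terms vanish. -/
theorem IsArnoldi.exists_hasSum_error (hV : IsEigenDecomposition C VC d) (hG : PosDefNonsymm G)
    (hγ : 0 < γ) (hA : IsArnoldi C (opS C G VC γ) (rangeProj VC) v m k W H) {c ρ r : ℝ}
    (h : NumRangeLE (coreT G (factorE VC d) γ) c ρ) (hρ : 0 < ρ) (hr : ρ < r) (hc : r < c) :
    ∃ δ : ℕ → EuclideanSpace ℂ (Fin n), (∀ j, ‖δ j‖ ≤ 4 * ρ ^ j * cNorm C v) ∧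
      ∀ (t : ℝ) (e l : ℕ), HasSum
        (fun j => circleCoeff c r (fun z => gInvPhi e l t (gInv γ z)) (j + m) • δ (j + m))
        (WithLp.toLp 2 fun i =>
          (((gInvPhi e l t (gInv γ (coreT G (factorE VC d) γ)) *ᵥ (factorE VC d *ᵥ v)
            - factorE VC d *ᵥ ((W * gInvPhi e l t (gInv γ H) * Wᵀ * C) *ᵥ v)) i : ℝ) : ℂ)) := by
  set E := factorE VC d with hE
  set T := coreT G E γ with hT
  set Q := E * W with hQdef
  have hQ : Qᵀ * Q = 1 := hA.transpose_mul_self hV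
  have hQ' : (toC Q)ᴴ * toC Q = 1 := by rw [conjTranspose_toC, ← toC_mul, hQ, toC_one]
  have hH : NumRangeLE H c ρ := by
    rw [hA.eq_compress hV hG hγ]
    exact h.compress hQ
  set b : Fin n → ℂ := fun i => ((E *ᵥ v) i : ℂ) with hb
  have hbn : ‖WithLp.toLp 2 b‖ = cNorm C v := by rw [hb, norm_toLp_ofReal, hV.cNorm_eq]
  -- The difference of the two `j`-th powers does not depend on the function, so one sequence `δ`
  -- serves all `t`, `e`, `l`. Each power contributes `2 ρ^j`, whence the constant `4`.
  set p : ℕ → Matrix (Fin n) (Fin n) ℂ := fun j =>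
    (toC T - algebraMap ℂ (Matrix (Fin n) (Fin n) ℂ) (c : ℂ)) ^ j
      - toC Q * (toC H - algebraMap ℂ (Matrix (Fin k) (Fin k) ℂ) (c : ℂ)) ^ j * (toC Q)ᴴ with hp
  refine ⟨fun j => WithLp.toLp 2 (p j *ᵥ b), fun j => ?_, fun t e l => ?_⟩
  · simp only [hp]
    rw [sub_mulVec, WithLp.toLp_sub, ← mulVec_mulVec, ← mulVec_mulVec]
    refine (norm_sub_le _ _).trans ?_
    rw [norm_toLp_mulVec_of_isometry hQ', ← hbn]
    have h1 := h.norm_pow_mulVec_le hρ j b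
    have h2 := hH.norm_pow_mulVec_le hρ j ((toC Q)ᴴ *ᵥ b)
    have h3 := mul_le_mul_of_nonneg_left (norm_toLp_conjTranspose_mulVec_le hQ' b)
      (by positivity : 0 ≤ 2 * ρ ^ j)
    linarith
  · have hzero : ∀ j < m, p j *ᵥ b = 0 := by
      intro j hj
      simp only [hp]
      rw [sub_mulVec, sub_eq_zero, toC_sub_algebraMap_pow, toC_sub_algebraMap_pow,
        conjTranspose_toC, ← toC_mul, ← toC_mul, hb, toC_mulVec_ofReal, toC_mulVec_ofReal,
        hA.pow_mulVec_eq hV hG hγ c hj]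
      simp only [hQdef, hE, mulVec_mulVec, Matrix.mul_assoc]
    set f : ℂ → ℂ := fun z => gInvPhi e l t (gInv γ z) with hf
    have s1 := h.hasSum_gInvPhi hρ hr hc γ t e l
    have s2 := hH.hasSum_gInvPhi hρ hr hc γ t e l
    have s3 : HasSum (fun j => circleCoeff c r f j • p j)
        (toC (gInvPhi e l t (gInv γ T)) - toC Q * toC (gInvPhi e l t (gInv γ H)) * (toC Q)ᴴ) := by
      have s4 : HasSum (fun j => toC Q * (circleCoeff c r f j •
          (toC H - algebraMap ℂ (Matrix (Fin k) (Fin k) ℂ) (c : ℂ)) ^ j) * (toC Q)ᴴ)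
          (toC Q * toC (gInvPhi e l t (gInv γ H)) * (toC Q)ᴴ) :=
        s2.map (AddMonoidHom.mk' (fun Z : Matrix (Fin k) (Fin k) ℂ => toC Q * Z * (toC Q)ᴴ)
          fun Y Z => by rw [Matrix.mul_add, Matrix.add_mul]) (by
            change Continuous fun Z : Matrix (Fin k) (Fin k) ℂ => toC Q * Z * (toC Q)ᴴ
            fun_prop)
      refine (s1.sub s4).congr_fun ?_
      intro j
      rw [hp, smul_sub, Matrix.mul_smul, Matrix.smul_mul]
    have s5 : HasSum (fun j => WithLp.toLp 2 ((circleCoeff c r f j • p j) *ᵥ b))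
        (WithLp.toLp 2 ((toC (gInvPhi e l t (gInv γ T))
          - toC Q * toC (gInvPhi e l t (gInv γ H)) * (toC Q)ᴴ) *ᵥ b)) :=
      s3.map (AddMonoidHom.mk' (fun Z : Matrix (Fin n) (Fin n) ℂ => WithLp.toLp 2 (Z *ᵥ b))
        fun Y Z => by rw [add_mulVec, WithLp.toLp_add]) (by
          change Continuous fun Z : Matrix (Fin n) (Fin n) ℂ => WithLp.toLp 2 (Z *ᵥ b)
          exact (PiLp.continuous_toLp 2 _).comp (continuous_id.matrix_mulVec continuous_const))
    have s6 := (hasSum_nat_add_iff' m).2 s5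
    rw [Finset.sum_eq_zero fun j hj => by
      rw [smul_mulVec, hzero j (Finset.mem_range.1 hj), smul_zero, WithLp.toLp_zero],
      sub_zero] at s6
    have e1 : (toC (gInvPhi e l t (gInv γ T))
          - toC Q * toC (gInvPhi e l t (gInv γ H)) * (toC Q)ᴴ) *ᵥ b
        = fun i => (((gInvPhi e l t (gInv γ T) *ᵥ (E *ᵥ v)
            - E *ᵥ ((W * gInvPhi e l t (gInv γ H) * Wᵀ * C) *ᵥ v)) i : ℝ) : ℂ) := by
      rw [conjTranspose_toC, ← toC_mul, ← toC_mul, ← toC_sub, hb, toC_mulVec_ofReal, sub_mulVec]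
      rw [hQdef, transpose_mul]
      conv_rhs => rw [hV.eq_transpose_mul]
      simp only [mulVec_mulVec, Matrix.mul_assoc]
      rfl
    rw [e1] at s6
    simpa only [smul_mulVec, WithLp.toLp_smul] using s6

end ErrorBound

/-- Unimodular constants align the phases of the three coefficients, so one Cauchy estimate applies
to a single combined function. This yields the maximum of the sum rather than the sum of the maxima.
-/
theorem sum_norm_circleCoeff_le {c : ℂ} {r : ℝ} (hr : 0 < r) {f g h : ℂ → ℂ} {a b w M : ℝ}
    (ha : 0 ≤ a) (hb : 0 ≤ b) (hw : 0 ≤ w)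
    (hf : ContinuousOn f (Metric.sphere c r)) (hg : ContinuousOn g (Metric.sphere c r))
    (hh : ContinuousOn h (Metric.sphere c r))
    (hM : ∀ z ∈ Metric.sphere c r, ‖f z‖ * a + ‖g z‖ * b + ‖h z‖ * w ≤ M) (j : ℕ) :
    ‖circleCoeff c r f j‖ * a + ‖circleCoeff c r g j‖ * b + ‖circleCoeff c r h j‖ * w
      ≤ M / r ^ j := by
  obtain ⟨e₁, h1, h1'⟩ := exists_norm_one_mul_eq_norm (circleCoeff c r f j)
  obtain ⟨e₂, h2, h2'⟩ := exists_norm_one_mul_eq_norm (circleCoeff c r g j)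
  obtain ⟨e₃, h3, h3'⟩ := exists_norm_one_mul_eq_norm (circleCoeff c r h j)
  have key := norm_circleCoeff_le hr (c := c)
    (h := fun z => (a * e₁) * f z + (b * e₂) * g z + (w * e₃) * h z) (M := M) (fun z hz => by
      refine ((norm_add_le _ _).trans (add_le_add_left (norm_add_le _ _) _)).trans
        (le_trans (le_of_eq ?_) (hM z hz))
      simp only [norm_mul, h1, h2, h3, Complex.norm_real, Real.norm_of_nonneg ha,
        Real.norm_of_nonneg hb, Real.norm_of_nonneg hw]
      ring) j
  rw [circleCoeff_add hr ((continuousOn_const.fun_mul hf).fun_add (continuousOn_const.fun_mul hg))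
    (continuousOn_const.fun_mul hh), circleCoeff_add hr (continuousOn_const.fun_mul hf)
    (continuousOn_const.fun_mul hg), circleCoeff_const_mul, circleCoeff_const_mul,
    circleCoeff_const_mul, mul_assoc, mul_assoc, mul_assoc, h1', h2', h3'] at key
  refine le_trans (le_of_eq ?_) key
  rw [← Complex.ofReal_mul, ← Complex.ofReal_mul, ← Complex.ofReal_mul, ← Complex.ofReal_add,
    ← Complex.ofReal_add, Complex.norm_real, Real.norm_of_nonneg (by positivity)]
  ring

/-! ### Combination of the three errors. -/

section FinalBound

variable {B : Type*} [Ring B] [Algebra ℝ B] [TopologicalSpace B]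

theorem gInvPhi_zero_zero (t : ℝ) (s : B) : gInvPhi 0 0 t s = phi 0 (-(t • s)) := by
  rw [gInvPhi, pow_zero, one_mul]

theorem gInvPhi_one (k : ℕ) (t : ℝ) (s : B) : gInvPhi 1 k t s = s * phi k (-(t • s)) := by
  rw [gInvPhi, pow_one]

theorem f0_eq_gInvPhi [Inv B] (γ t : ℝ) (a : B) : f0 γ t a = gInvPhi 0 0 t (gInv γ a) := by
  rw [f0, gInvPhi_zero_zero]

theorem fk_eq_gInvPhi [Inv B] (k : ℕ) (γ t : ℝ) (a : B) :
    fk k γ t a = gInvPhi 1 k t (gInv γ a) := by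
  rw [fk, gInvPhi_one]

variable {N n : ℕ} {C G : Matrix (Fin N) (Fin N) ℝ} {VC : Matrix (Fin N) (Fin n) ℝ} {d : Fin n → ℝ}

theorem exists_isGreatest_and_error_le (hV : IsEigenDecomposition C VC d) (hG : PosDefNonsymm G)
    {γ : ℝ} (hγ : 0 < γ) {c ρ r : ℝ} (hρ : 0 < ρ) (hc1 : c ≤ 1)
    (hS : cNumericalRange C (opS C G VC γ) ⊆ Metric.closedBall (c : ℂ) ρ) (hr : ρ < r)
    (hc : r < c) {t : ℝ} (ht : 0 ≤ t) (x₀ u₀ u₁ : Fin N → ℝ) {m k₀ k₁ k₂ : ℕ}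
    {W₀ : Matrix (Fin N) (Fin k₀) ℝ} {H₀ : Matrix (Fin k₀) (Fin k₀) ℝ}
    {W₁ : Matrix (Fin N) (Fin k₁) ℝ} {H₁ : Matrix (Fin k₁) (Fin k₁) ℝ}
    {W₂ : Matrix (Fin N) (Fin k₂) ℝ} {H₂ : Matrix (Fin k₂) (Fin k₂) ℝ}
    (hA₀ : IsArnoldi C (opS C G VC γ) (rangeProj VC) x₀ m k₀ W₀ H₀)
    (hA₁ : IsArnoldi C (opS C G VC γ) (rangeProj VC) (G⁻¹ *ᵥ u₀) m k₁ W₁ H₁)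
    (hA₂ : IsArnoldi C (opS C G VC γ) (rangeProj VC) (G⁻¹ *ᵥ u₁) m k₂ W₂ H₂) :
    ∃ M : ℝ,
      IsGreatest ((fun z : ℂ => ‖f0 γ t z‖ * cNorm C x₀
          + t * ‖fk 1 γ t z‖ * cNorm C (G⁻¹ *ᵥ u₀)
          + t ^ 2 * ‖fk 2 γ t z‖ * cNorm C (G⁻¹ *ᵥ u₁)) '' Metric.sphere (c : ℂ) r) M ∧
      cNorm C (xR C G VC t x₀ u₀ u₁ - xa C G γ t x₀ u₀ u₁ W₀ H₀ W₁ H₁ W₂ H₂)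
        ≤ M * (4 / (r - ρ)) * (ρ / r) ^ m := by
  have hr0 : 0 < r := hρ.trans hr
  have h0 := zero_notMem_closedBall hr0 hc
  simp only [f0_eq_gInvPhi, fk_eq_gInvPhi]
  have c0 := continuousOn_gInvPhi h0 0 0 γ t
  have c1 := continuousOn_gInvPhi h0 1 1 γ t
  have c2 := continuousOn_gInvPhi h0 1 2 γ t
  have hcont : ContinuousOn (fun z : ℂ => ‖gInvPhi 0 0 t (gInv γ z)‖ * cNorm C x₀
          + t * ‖gInvPhi 1 1 t (gInv γ z)‖ * cNorm C (G⁻¹ *ᵥ u₀)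
          + t ^ 2 * ‖gInvPhi 1 2 t (gInv γ z)‖ * cNorm C (G⁻¹ *ᵥ u₁))
      (Metric.sphere (c : ℂ) r) := by fun_prop
  have hne : (Metric.sphere (c : ℂ) r).Nonempty := NormedSpace.sphere_nonempty.2 hr0.le
  obtain ⟨M, hM⟩ := ((isCompact_sphere (c : ℂ) r).image_of_continuousOn hcont).exists_isGreatest
    (hne.image _)
  refine ⟨M, hM, ?_⟩
  have n0 : 0 ≤ cNorm C x₀ := Real.sqrt_nonneg _
  have n1 : 0 ≤ cNorm C (G⁻¹ *ᵥ u₀) := Real.sqrt_nonneg _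
  have n2 : 0 ≤ cNorm C (G⁻¹ *ᵥ u₁) := Real.sqrt_nonneg _
  have hM0 : 0 ≤ M := by
    obtain ⟨z, -, rfl⟩ := hM.1
    positivity
  have hcoeff := sum_norm_circleCoeff_le hr0 n0 (mul_nonneg ht n1) (mul_nonneg (sq_nonneg t) n2)
    c0 c1 c2 (M := M) fun z hz => by
      have := hM.2 (Set.mem_image_of_mem _ hz)
      linarith
  have hT : NumRangeLE (coreT G (factorE VC d) γ) c ρ :=
    hV.norm_inner_sub_le (hV.factorE_mul_opS hG hγ) hS
  obtain ⟨δ₀, b0, s0⟩ := hA₀.exists_hasSum_error hV hG hγ hT hρ hr hc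
  obtain ⟨δ₁, b1, s1⟩ := hA₁.exists_hasSum_error hV hG hγ hT hρ hr hc
  obtain ⟨δ₂, b2, s2⟩ := hA₂.exists_hasSum_error hV hG hγ hT hρ hr hc
  have hsum := ((s0 t 0 0).add ((s1 t 1 1).const_smul (t : ℂ))).add
    ((s2 t 1 2).const_smul ((t ^ 2 : ℝ) : ℂ))
  -- Replacing `σ(T)` by `M⁻¹` turns the functions of `T` into the terms of `coreSol`.
  rw [gInv_coreT (hV.posDefNonsymm_coreM hG) hγ] at hsum
  have hgeo : HasSum (fun j => 4 * M * (ρ / r) ^ m * (ρ / r) ^ j)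
      (4 * M * (ρ / r) ^ m * (1 - ρ / r)⁻¹) :=
    (hasSum_geometric_of_lt_one (by positivity) ((div_lt_one hr0).2 hr)).mul_left _
  have hbound := hsum.norm_le_of_bounded hgeo fun j => by
    set z0 := circleCoeff c r (fun z => gInvPhi 0 0 t (gInv γ z)) (j + m)
    set z1 := circleCoeff c r (fun z => gInvPhi 1 1 t (gInv γ z)) (j + m)
    set z2 := circleCoeff c r (fun z => gInvPhi 1 2 t (gInv γ z)) (j + m)
    have q0 : ‖z0 • δ₀ (j + m)‖ ≤ ‖z0‖ * (4 * ρ ^ (j + m) * cNorm C x₀) := by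
      rw [norm_smul]
      exact mul_le_mul_of_nonneg_left (b0 _) (norm_nonneg _)
    have q1 : ‖(t : ℂ) • z1 • δ₁ (j + m)‖
        ≤ t * (‖z1‖ * (4 * ρ ^ (j + m) * cNorm C (G⁻¹ *ᵥ u₀))) := by
      rw [norm_smul, norm_smul, Complex.norm_real, Real.norm_of_nonneg ht]
      exact mul_le_mul_of_nonneg_left (mul_le_mul_of_nonneg_left (b1 _) (norm_nonneg _)) ht
    have q2 : ‖((t ^ 2 : ℝ) : ℂ) • z2 • δ₂ (j + m)‖
        ≤ t ^ 2 * (‖z2‖ * (4 * ρ ^ (j + m) * cNorm C (G⁻¹ *ᵥ u₁))) := by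
      rw [norm_smul, norm_smul, Complex.norm_real, Real.norm_of_nonneg (sq_nonneg t)]
      exact mul_le_mul_of_nonneg_left (mul_le_mul_of_nonneg_left (b2 _) (norm_nonneg _))
        (sq_nonneg t)
    refine (norm_add_le _ _).trans ((add_le_add ((norm_add_le _ _).trans (add_le_add q0 q1))
      q2).trans ?_)
    have q3 := mul_le_mul_of_nonneg_left (hcoeff (j + m))
      (by positivity : 0 ≤ 4 * ρ ^ (j + m))
    have q4 : 4 * ρ ^ (j + m) * (M / r ^ (j + m)) = 4 * M * (ρ / r) ^ m * (ρ / r) ^ j := by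
      rw [mul_assoc (4 * M), ← pow_add, add_comm m j, div_pow]
      ring
    rw [← q4]
    refine le_trans (le_of_eq ?_) q3
    ring
  have hfinal : cNorm C (xR C G VC t x₀ u₀ u₁ - xa C G γ t x₀ u₀ u₁ W₀ H₀ W₁ H₁ W₂ H₂)
      ≤ 4 * M * (ρ / r) ^ m * (1 - ρ / r)⁻¹ := by
    refine le_trans (le_of_eq ?_) hbound
    rw [hV.cNorm_eq, ← norm_toLp_ofReal, ← WithLp.toLp_smul, ← WithLp.toLp_smul,
      ← WithLp.toLp_add, ← WithLp.toLp_add]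
    congr 2
    funext i
    simp only [Pi.add_apply, Pi.smul_apply, smul_eq_mul, ← Complex.ofReal_mul,
      ← Complex.ofReal_add]
    congr 1
    rw [mulVec_sub, xR_eq hV hG, mulVec_mulVec, hV.factorE_mul_factorF, one_mulVec, xa, coreSol]
    simp only [f0_eq_gInvPhi, fk_eq_gInvPhi,  ← gInvPhi_one, ← gInvPhi_zero_zero, mulVec_add, mulVec_smul, Pi.sub_apply, Pi.add_apply,
      Pi.smul_apply, smul_eq_mul]
    ring
  refine hfinal.trans ?_
  -- The geometric series gives the factor `r / (r - ρ)`; the numerator is dropped because `r < c ≤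
  -- 1`.
  have hlast : (1 - ρ / r)⁻¹ ≤ 1 / (r - ρ) := by
    have : (1 - ρ / r)⁻¹ = r / (r - ρ) := by
      field_simp
    rw [this]
    exact div_le_div_of_nonneg_right (by linarith) (by linarith)
  calc 4 * M * (ρ / r) ^ m * (1 - ρ / r)⁻¹ ≤ 4 * M * (ρ / r) ^ m * (1 / (r - ρ)) := by gcongr
    _ = _ := by ring

end FinalBound

end CArnoldi

end

theorem mainTheorem1 {N n : ℕ} (C G : Matrix (Fin N) (Fin N) ℝ)
    (hC : C.PosSemidef) (hG : CArnoldi.PosDefNonsymm G)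
    (VC : Matrix (Fin N) (Fin n) ℝ) (d : Fin n → ℝ)
    (hV : CArnoldi.IsEigenDecomposition C VC d) :
    -- the disks for `B` and for `S`
    (∃ c₁ ρ₁ : ℝ, 0 < ρ₁ ∧ ρ₁ < c₁ ∧
      CArnoldi.cNumericalRange C (CArnoldi.opB C G) ⊆ Metric.closedBall (c₁ : ℂ) ρ₁ ∧
      ∀ γ : ℝ, 0 < γ →
        0 < CArnoldi.diskRadius γ c₁ ρ₁ ∧
        CArnoldi.diskRadius γ c₁ ρ₁ < CArnoldi.diskCentre γ c₁ ρ₁ ∧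
        CArnoldi.diskCentre γ c₁ ρ₁ < 1 ∧
        CArnoldi.cNumericalRange C (CArnoldi.opS C G VC γ) ⊆
          Metric.closedBall (CArnoldi.diskCentre γ c₁ ρ₁ : ℂ) (CArnoldi.diskRadius γ c₁ ρ₁)) ∧
    -- `xR` is the range component of every solution of the differential algebraic system
    (∀ (x x' : ℝ → Fin N → ℝ) (u₀ u₁ : Fin N → ℝ),
      (∀ s : ℝ, 0 ≤ s → HasDerivWithinAt x (x' s) (Set.Ici 0) s ∧
        C *ᵥ x' s + G *ᵥ x s = u₀ + s • u₁) →
      ∀ t : ℝ, 0 ≤ t →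
        CArnoldi.rangeProj VC *ᵥ x t = CArnoldi.xR C G VC t (x 0) u₀ u₁) ∧
    -- the error bound
    (∀ γ : ℝ, 0 < γ → ∀ c₀ ρ₀ : ℝ, 0 < ρ₀ → ρ₀ < c₀ → c₀ ≤ 1 →
      CArnoldi.cNumericalRange C (CArnoldi.opS C G VC γ) ⊆ Metric.closedBall (c₀ : ℂ) ρ₀ →
      ∀ r : ℝ, ρ₀ < r → r < c₀ →
      ∀ (t : ℝ), 0 ≤ t → ∀ (x₀ u₀ u₁ : Fin N → ℝ) (m : ℕ), 1 ≤ m →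
      ∀ (k₀ k₁ k₂ : ℕ)
        (W₀ : Matrix (Fin N) (Fin k₀) ℝ) (H₀ : Matrix (Fin k₀) (Fin k₀) ℝ)
        (W₁ : Matrix (Fin N) (Fin k₁) ℝ) (H₁ : Matrix (Fin k₁) (Fin k₁) ℝ)
        (W₂ : Matrix (Fin N) (Fin k₂) ℝ) (H₂ : Matrix (Fin k₂) (Fin k₂) ℝ),
      CArnoldi.IsArnoldi C (CArnoldi.opS C G VC γ) (CArnoldi.rangeProj VC) x₀ m k₀ W₀ H₀ →
      CArnoldi.IsArnoldi C (CArnoldi.opS C G VC γ) (CArnoldi.rangeProj VC) (G⁻¹ *ᵥ u₀)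
        m k₁ W₁ H₁ →
      CArnoldi.IsArnoldi C (CArnoldi.opS C G VC γ) (CArnoldi.rangeProj VC) (G⁻¹ *ᵥ u₁)
        m k₂ W₂ H₂ →
      ∃ M : ℝ,
        IsGreatest ((fun z : ℂ => ‖CArnoldi.f0 γ t z‖ * CArnoldi.cNorm C x₀
            + t * ‖CArnoldi.fk 1 γ t z‖ * CArnoldi.cNorm C (G⁻¹ *ᵥ u₀)
            + t ^ 2 * ‖CArnoldi.fk 2 γ t z‖ * CArnoldi.cNorm C (G⁻¹ *ᵥ u₁)) ''
          Metric.sphere (c₀ : ℂ) r) M ∧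
        CArnoldi.cNorm C (CArnoldi.xR C G VC t x₀ u₀ u₁
            - CArnoldi.xa C G γ t x₀ u₀ u₁ W₀ H₀ W₁ H₁ W₂ H₂)
          ≤ M * (4 / (r - ρ₀)) * (ρ₀ / r) ^ m) := by
  exact ⟨CArnoldi.exists_disk hV hG,
    fun x x' u₀ u₁ h t ht => CArnoldi.rangeProj_mulVec_eq_xR hV hG x x' u₀ u₁ h ht,
    fun γ hγ c₀ ρ₀ hρ _ hc1 hS r hr hc t ht x₀ u₀ u₁ m _ k₀ k₁ k₂ W₀ H₀ W₁ H₁ W₂ H₂ hA₀ hA₁ hA₂ =>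
      CArnoldi.exists_isGreatest_and_error_le hV hG hγ hρ hc1 hS hr hc ht x₀ u₀ u₁ hA₀ hA₁ hA₂⟩
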